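/- Fix a base game $\mathcal G$: a finite set $I$ of players; a finite set $\Theta$ of payoff states with a full-support prior $\pi\in\Delta(\Theta)$; and, for each $i\in I$, a finite nonempty action set $A_i$ and a utility $u_i:A\times\Theta\to\mathbb R$, where $A=\prod_{i}A_i$. An information technology $\mathcal T=(Z,\zeta,(X_i,\mathcal E_i,C_i)_{i\in I})$ consists of a finite set $Z$; a Markov kernel $\zeta:\Theta\to\Delta(Z)$; for each $i$, a finite signal space $X_i$ with $|X_i|>|A_i|$ and $|X_i|>|Z\times\Theta|$; a set $\mathcal E_i$ of feasible experiments $\xi_i:Z\times\Theta\to\Delta(X_i)$; and a cost function $C_i:\mathcal E_i\to\mathbb R_+$ that vanishes at some feasible experiment. In the game $(\mathcal G,\mathcal T)$ each player $i$ simultaneously chooses $\xi_i\in\mathcal E_i$ and an action plan $\sigma_i:X_i\to\Delta(A_i)$; her payoff, called her value, is $$\sum_{a,x,z,\theta}u_i(a,\theta)\Big[\prod_{j\in I}\sigma_j(a_j|x_j)\,\xi_j(x_j|z,\theta)\Big]\zeta(z|\theta)\pi(\theta)-C_i(\xi_i).$$ Equilibrium means Nash equilibrium, and the outcome is the induced joint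 distribution of $(a,\theta)$. Write $\xi_i\succsim\xi_i'$ if there is a kernel $g:X_i\to\Delta(X_i)$ with $\xi_i'(x|z,\theta)=\sum_{x'}g(x|x')\,\xi_i(x'|z,\theta)$ for all $x$ and all $(z,\theta)$ with $\zeta(z|\theta)>0$, and $\xi_i\succ\xi_i'$ if $\xi_i\succsim\xi_i'$ and not $\xi_i'\succsim\xi_i$. The technology $\mathcal T$ is a rational-inattention technology if, for every $i$, $\xi_i\in\mathcal E_i$ and $\xi_i\succsim\xi_i'$ imply $\xi_i'\in\mathcal E_i$, and for $\xi_i,\xi_i'\in\mathcal E_i$, $\xi_i\succsim\xi_i'$ implies $C_i(\xi_i)\ge C_i(\xi_i')$ and $\xi_i\succ\xi_i'$ implies $C_i(\xi_i)>C_i(\xi_i')$. For $p\in\Delta(A\times\Theta)$ and an action $a_i$ with marginal probability $p(a_i)>0$, let $p_{a_i}\in\Delta(A_{-i}\times\Theta)$ be the conditional distribution of $(a_{-i},\theta)$ given $a_i$, and $BR(p_{a_i})=\arg\max_{b_i\in A_i}\sum_{a_{-i},\theta}u_i(b_i,a_{-i},\theta)\,p_{a_i}(a_{-i},\theta)$.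 Call $p$ a separated BCE if its marginal on $\Theta$ is $\pi$; for all $i$ and $a_i,b_i\in A_i$, $$\sum_{a_{-i},\theta}\big(u_i(a_i,a_{-i},\theta)-u_i(b_i,a_{-i},\theta)\big)\,p(a_i,a_{-i},\theta)\ge0;$$ and for all $i$ and $a_i,b_i\in A_i$ with $p(a_i),p(b_i)>0$, $p_{a_i}\ne p_{b_i}$ implies $BR(p_{a_i})\cap BR(p_{b_i})=\varnothing$. Let $\bar v_i(p)=\sum_{a,\theta}u_i(a,\theta)p(a,\theta)$ be the gross value and $\underline v_i(p)=\max_{b_i\in A_i}\sum_{a,\theta}u_i(b_i,a_{-i},\theta)p(a,\theta)$ the uninformed value. **Theorem.** Let $p$ be a probability distribution on $A\times\Theta$ and $v\in\mathbb R^I$. There exists a rational-inattention technology $\mathcal T$ such that some equilibrium of $(\mathcal G,\mathcal T)$ has outcome $p$ and value vector $v$ if and only if 1. $p$ is a separated BCE, and 2. for every $i\in I$, either $v_i=\underline v_i(p)=\bar v_i(p)$ or $v_i\in[\underline v_i(p),\bar v_i(p))$. -/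

import Mathlib

open Finset
open scoped NNReal

universe uI uT uA w

/-- A base game with finite player set `I`, finite set `Θ` of payoff states and finite action sets
`A i`: a full-support prior on `Θ` and a utility function for each player. -/
structure BaseGame (I : Type uI) (Θ : Type uT) (A : I → Type uA) [Fintype Θ] where
  /-- the prior `π` -/
  prior : Θ → ℝ
  prior_mem : prior ∈ stdSimplex ℝ Θ
  prior_pos : ∀ θ, 0 < prior θ
  /-- `u i a θ` is the utility of player `i` -/
  u : I → (∀ i, A i) → Θ → ℝ

/-- Markov kernels `S → Δ(X)`; `k s x` is the probability of `x` given `s`. -/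
abbrev FinKernel (S : Type*) (X : Type*) [Fintype X] := S → stdSimplex ℝ X

section Blackwell

variable {Z Θ X : Type*} [Fintype Z] [Fintype X]

/-- `ξ` Blackwell dominates `ξ'`: some garbling of `ξ` agrees with `ξ'` at every state `(z, θ)`
with `ζ(z ∣ θ) > 0`. -/
def BlackwellDominates (ζ : FinKernel Θ Z) (ξ ξ' : FinKernel (Z × Θ) X) : Prop :=
  ∃ g : FinKernel X X, ∀ (x : X) (θ : Θ) (z : Z), 0 < ζ θ z →
    ξ' (z, θ) x = ∑ x' : X, g x' x * ξ (z, θ) x'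

/-- Strict Blackwell dominance. -/
def StrictlyBlackwellDominates (ζ : FinKernel Θ Z) (ξ ξ' : FinKernel (Z × Θ) X) : Prop :=
  BlackwellDominates ζ ξ ξ' ∧ ¬ BlackwellDominates ζ ξ' ξ

end Blackwell

/-- An information technology for players `I` with action sets `A i` and payoff states `Θ`. -/
structure InformationTechnology (I : Type uI) (Θ : Type uT) (A : I → Type uA)
    [Fintype Θ] [∀ i, Fintype (A i)] where
  /-- values of the additional exogenous variable `z` -/
  Z : Type w
  [fintypeZ : Fintype Z]
  /-- conditional distribution of `z` given `θ` -/
  ζ : FinKernel Θ Z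
  /-- signal realizations of player `i` -/
  X : I → Type w
  [fintypeX : ∀ i, Fintype (X i)]
  /-- feasible experiments of player `i` -/
  feasible : ∀ i, Set (FinKernel (Z × Θ) (X i))
  /-- information costs of player `i` -/
  cost : ∀ i, feasible i → ℝ≥0
  /-- the signal spaces are rich -/
  card_action_lt : ∀ i, Fintype.card (A i) < Fintype.card (X i)
  card_state_lt : ∀ i, Fintype.card (Z × Θ) < Fintype.card (X i)
  /-- some feasible experiment is free -/
  exists_free : ∀ i, ∃ ξ : feasible i, cost i ξ = 0

attribute [instance] InformationTechnology.fintypeZ InformationTechnology.fintypeX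

namespace InformationTechnology

variable {I : Type uI} {Θ : Type uT} {A : I → Type uA} [Fintype Θ] [∀ i, Fintype (A i)]

/-- Less information than a feasible amount is feasible. -/
def IsFlexible (T : InformationTechnology.{uI, uT, uA, w} I Θ A) (i : I) : Prop :=
  ∀ ξ ∈ T.feasible i, ∀ ξ' : FinKernel (T.Z × Θ) (T.X i),
    BlackwellDominates T.ζ ξ ξ' → ξ' ∈ T.feasible i

/-- More information is more costly, strictly so if it is strictly more information. -/
def IsMonotone (T : InformationTechnology.{uI, uT, uA, w} I Θ A) (i : I) : Prop :=
  ∀ ξ ξ' : T.feasible i,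
    (BlackwellDominates T.ζ ξ.1 ξ'.1 → T.cost i ξ' ≤ T.cost i ξ) ∧
    (StrictlyBlackwellDominates T.ζ ξ.1 ξ'.1 → T.cost i ξ' < T.cost i ξ)

/-- The technology represents rational inattention. -/
def IsRationalInattention (T : InformationTechnology.{uI, uT, uA, w} I Θ A) : Prop :=
  ∀ i, T.IsFlexible i ∧ T.IsMonotone i

/-- A strategy of player `i`: a feasible experiment and an action plan. -/
abbrev Strategy (T : InformationTechnology.{uI, uT, uA, w} I Θ A) (i : I) :=
  T.feasible i × FinKernel (T.X i) (A i)

end InformationTechnology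

namespace BaseGame

variable {I : Type uI} {Θ : Type uT} {A : I → Type uA}
  [Fintype I] [DecidableEq I] [Fintype Θ] [∀ i, Fintype (A i)]

section Equilibrium

variable (G : BaseGame I Θ A) (T : InformationTechnology.{uI, uT, uA, w} I Θ A)

/-- Joint probability of actions `a`, signals `x` and states `z`, `θ` under a strategy profile. -/
def jointProb (s : ∀ i, T.Strategy i) (a : ∀ i, A i) (x : ∀ i, T.X i) (z : T.Z) (θ : Θ) : ℝ :=
  (∏ i, (s i).2 (x i) (a i) * (s i).1.1 (z, θ) (x i)) * T.ζ θ z * G.prior θ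

/-- The outcome of a strategy profile: the joint distribution of actions and payoff state. -/
def outcome (s : ∀ i, T.Strategy i) (a : ∀ i, A i) (θ : Θ) : ℝ :=
  ∑ x : ∀ i, T.X i, ∑ z : T.Z, G.jointProb T s a x z θ

/-- Player `i`'s value: the expected utility minus the cost of the experiment. -/
def value (s : ∀ i, T.Strategy i) (i : I) : ℝ :=
  (∑ a : ∀ i, A i, ∑ x : ∀ i, T.X i, ∑ z : T.Z, ∑ θ : Θ, G.u i a θ * G.jointProb T s a x z θ)
    - T.cost i (s i).1

/-- Nash equilibrium of the information acquisition game. -/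
def IsEquilibrium (s : ∀ i, T.Strategy i) : Prop :=
  ∀ (i : I) (s' : T.Strategy i), G.value T (Function.update s i s') i ≤ G.value T s i

/-- The technology induces the outcome-value pair `(p, v)` in an equilibrium. -/
def Induces (p : (∀ i, A i) → Θ → ℝ) (v : I → ℝ) : Prop :=
  ∃ s : ∀ i, T.Strategy i, G.IsEquilibrium T s ∧ G.outcome T s = p ∧ G.value T s = v

end Equilibrium

/-- Action profiles of the players other than `i`. -/
abbrev OtherActions (A : I → Type uA) (i : I) := ∀ j : {j // j ≠ i}, A j

/-- The action profile `(aᵢ, a₋ᵢ)`. -/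
def profile (i : I) (ai : A i) (am : OtherActions A i) : ∀ j, A j :=
  (Equiv.piSplitAt i A).symm (ai, am)

variable (G : BaseGame I Θ A) (p : (∀ i, A i) → Θ → ℝ)

/-- `p` is a probability on action profiles and payoff states whose marginal on `Θ` is the prior. -/
def IsOutcome : Prop :=
  (∀ a θ, 0 ≤ p a θ) ∧ (∑ a, ∑ θ, p a θ = 1) ∧ ∀ θ, ∑ a, p a θ = G.prior θ

/-- The obedience constraint. -/
def IsObedient : Prop :=
  ∀ (i : I) (ai bi : A i),
    0 ≤ ∑ am : OtherActions A i, ∑ θ : Θ,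
      (G.u i (profile i ai am) θ - G.u i (profile i bi am) θ) * p (profile i ai am) θ

/-- Bayes correlated equilibrium. -/
def IsBCE : Prop := G.IsOutcome p ∧ G.IsObedient p

/-- The probability that player `i` takes action `ai`. -/
def actionProb (i : I) (ai : A i) : ℝ :=
  ∑ am : OtherActions A i, ∑ θ : Θ, p (profile i ai am) θ

/-- Player `i`'s actions that have positive probability. -/
def actionSupp (i : I) : Set (A i) := {ai | 0 < actionProb p i ai}

/-- The conditional distribution of the other players' actions and the payoff state given `ai`
(used for actions of positive probability only). -/
noncomputable def posterior (i : I) (ai : A i) (am : OtherActions A i) (θ : Θ) : ℝ :=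
  p (profile i ai am) θ / actionProb p i ai

/-- Player `i`'s best responses to a belief `q`. -/
def bestResponses (i : I) (q : OtherActions A i → Θ → ℝ) : Set (A i) :=
  {bi | ∀ ci : A i, ∑ am, ∑ θ, G.u i (profile i ci am) θ * q am θ
    ≤ ∑ am, ∑ θ, G.u i (profile i bi am) θ * q am θ}

/-- The separation constraint. -/
def IsSeparated : Prop :=
  ∀ (i : I), ∀ ai ∈ actionSupp p i, ∀ bi ∈ actionSupp p i, posterior p i ai ≠ posterior p i bi →
    G.bestResponses i (posterior p i ai) ∩ G.bestResponses i (posterior p i bi) = ∅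

/-- Separated Bayes correlated equilibrium. -/
def IsSeparatedBCE : Prop := G.IsBCE p ∧ G.IsSeparated p

/-- The gross value of `p` for player `i`. -/
def grossValue (i : I) : ℝ := ∑ a, ∑ θ, G.u i a θ * p a θ

/-- The uninformed value of `p` for player `i`. -/
def uninformedValue [∀ i, Nonempty (A i)] (i : I) : ℝ :=
  Finset.univ.sup' Finset.univ_nonempty fun bi : A i =>
    ∑ a, ∑ θ, G.u i (Function.update a i bi) θ * p a θ

end BaseGame

/-! An experiment is encoded by its columns: one vector of `ζ`-weighted likelihoods per signal. A
garbling mixes columns by a Markov kernel, so a sum over signals of a sublinear functional `W` of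
the columns never rises under garbling. Two choices of `W` carry the proof. The maximal expected
payoff gives the value of an experiment. The Euclidean norm gives `informativeness`, which by strict
convexity falls strictly unless the garbling can be undone (`exists_reverse_of_sum_norm_le`).

Necessity: obedience and the lower bound on the value come from remapping actions and from playing a
constant action at a free experiment. If two recommended actions share a best response, pooling them
and playing it keeps the gross value. As cost is strictly monotone, the pooling must lose no
information, so the two columns are parallel and the posteriors agree. A free experiment is
uninformative, which gives the dichotomy for `v i`.

Sufficiency: let `z` be an action profile drawn from `p` given `θ`. Each player may buy garblings of
the experiment that reveals the posterior class of her recommendation, and she redraws her action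
within the class. Separation makes every strictly less informative garbling strictly less valuable.
This leaves room for a strictly monotone cost whose savings never exceed the lost value
(`exists_monotone_cost`), with cost `grossValue - v i` at the full experiment. -/

/-! ### Markov kernels -/

namespace FinKernel

variable {S X Y : Type*} [Fintype X] [Fintype Y]

/-- Composition of Markov kernels. -/
def comp (g : FinKernel S X) (h : FinKernel X Y) : FinKernel S Y := fun s =>
  ⟨fun y => ∑ x, g s x * h x y, fun y => sum_nonneg fun x _ =>
    mul_nonneg (stdSimplex.zero_le _ _) (stdSimplex.zero_le _ _), by
    rw [sum_comm]
    simp [← mul_sum]⟩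

theorem comp_apply (g : FinKernel S X) (h : FinKernel X Y) (s : S) (y : Y) :
    g.comp h s y = ∑ x, g s x * h x y := rfl

open scoped Classical in
/-- The deterministic kernel of a function. -/
noncomputable def ofFun (f : S → X) : FinKernel S X := fun s => stdSimplex.vertex (f s)

open scoped Classical in
theorem ofFun_apply (f : S → X) (s : S) (x : X) :
    ofFun f s x = if x = f s then 1 else 0 := by
  simp [ofFun, Pi.single_apply]

end FinKernel

/-! ### Sublinear functionals under garbling -/

section Sublinear

variable {E : Type*} [AddCommGroup E] [Module ℝ E] {W : E → ℝ}

/-- Subadditivity and positive homogeneity. -/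
structure IsSublinear (W : E → ℝ) : Prop where
  add_le : ∀ x y, W (x + y) ≤ W x + W y
  smul : ∀ r : ℝ, 0 ≤ r → ∀ x, W (r • x) = r * W x

theorem IsSublinear.sum_le (hW : IsSublinear W) {ι : Type*} (s : Finset ι) (v : ι → E) :
    W (∑ i ∈ s, v i) ≤ ∑ i ∈ s, W (v i) := by
  classical
  induction s using Finset.induction_on with
  | empty => simpa using (hW.smul 0 le_rfl 0).le
  | insert i s hi ih =>
    rw [sum_insert hi, sum_insert hi]
    exact (hW.add_le _ _).trans (by gcongr)

theorem IsSublinear.sum_smul_le (hW : IsSublinear W) {ι : Type*} [Fintype ι] (r : ι → ℝ)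
    (hr : ∀ i, 0 ≤ r i) (v : ι → E) :
    W (∑ i, r i • v i) ≤ ∑ i, r i * W (v i) :=
  (hW.sum_le _ _).trans (sum_le_sum fun i _ => (hW.smul _ (hr i) _).le)

variable {X Y : Type*} [Fintype X] [Fintype Y]

theorem FinKernel.sum_sum_mul (g : FinKernel X Y) (f : X → ℝ) :
    ∑ y, ∑ x, g x y * f x = ∑ x, f x := by
  rw [sum_comm]
  simp [← sum_mul]

/-- Sublinearity bounds each mixed column by the mixture of values, and the kernel weights of each
`x` sum to one. -/
theorem IsSublinear.garble_le (hW : IsSublinear W) (g : FinKernel X Y) (v : X → E) :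
    ∑ y, W (∑ x, g x y • v x) ≤ ∑ x, W (v x) := by
  rw [← g.sum_sum_mul]
  exact sum_le_sum fun y _ => hW.sum_smul_le _ (fun x => stdSimplex.zero_le _ _) _

/-- If garbling does not decrease a sublinear functional, it is additive on every signal. -/
theorem IsSublinear.garble_eq (hW : IsSublinear W) (g : FinKernel X Y) (v : X → E)
    (h : ∑ x, W (v x) ≤ ∑ y, W (∑ x, g x y • v x)) (y : Y) :
    W (∑ x, g x y • v x) = ∑ x, g x y * W (v x) := by
  have h1 := hW.garble_le g v
  rw [← g.sum_sum_mul] at h h1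
  exact (sum_eq_sum_iff_of_le fun y _ =>
    hW.sum_smul_le (fun x => g x y) (fun x => stdSimplex.zero_le _ _) v).1 (le_antisymm h1 h) y
      (mem_univ _)

theorem isSublinear_sup' {ι : Type*} [Fintype ι] [Nonempty ι] (l : ι → E →ₗ[ℝ] ℝ) :
    IsSublinear fun v => univ.sup' univ_nonempty fun i => l i v := by
  constructor
  · intro x y
    refine sup'_le _ _ fun i _ => ?_
    rw [map_add]
    exact add_le_add (le_sup' (fun i => l i x) (mem_univ i)) (le_sup' (fun i => l i y) (mem_univ i))
  · intro r hr x
    simp only [map_smul, smul_eq_mul]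
    rw [mul₀_sup' hr]

end Sublinear

theorem isSublinear_norm {E : Type*} [NormedAddCommGroup E] [NormedSpace ℝ E] :
    IsSublinear fun v : E => ‖v‖ :=
  ⟨norm_add_le, fun r hr x => by rw [norm_smul, Real.norm_of_nonneg hr]⟩

/-! ### Equality in the triangle inequality and reversible garblings -/

section StrictConvex

variable {E : Type*} [NormedAddCommGroup E] [NormedSpace ℝ E] [StrictConvexSpace ℝ E]

/-- Equality for the whole sum forces equality between `v i` and the sum of the rest, so strict
convexity puts these two on one ray. -/
theorem norm_smul_sum_eq_of_norm_sum_eq {ι : Type*} [Fintype ι] (v : ι → E)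
    (h : ‖∑ i, v i‖ = ∑ i, ‖v i‖) (i : ι) : ‖v i‖ • ∑ j, v j = ‖∑ j, v j‖ • v i := by
  classical
  have h1 : ∑ j, v j = v i + ∑ j ∈ univ.erase i, v j := (add_sum_erase _ _ (mem_univ i)).symm
  have h2 : ∑ j, ‖v j‖ = ‖v i‖ + ∑ j ∈ univ.erase i, ‖v j‖ :=
    (add_sum_erase _ _ (mem_univ i)).symm
  have h3 : SameRay ℝ (v i) (∑ j ∈ univ.erase i, v j) := by
    rw [sameRay_iff_norm_add, ← h1]
    refine le_antisymm (h1 ▸ norm_add_le _ _) ?_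
    rw [h, h2]
    gcongr
    exact norm_sum_le _ _
  have h4 : SameRay ℝ (v i) (∑ j, v j) := by
    rw [h1]
    exact (SameRay.refl _).add_right h3
  exact h4.norm_smul_eq

variable {X Y : Type*} [Fintype X] [Fintype Y]

/-- A garbling that keeps the total norm of the columns can be undone. -/
theorem exists_reverse_of_sum_norm_le [Nonempty X] (g : FinKernel X Y) (v : X → E)
    (h : ∑ x, ‖v x‖ ≤ ∑ y, ‖∑ x, g x y • v x‖) :
    ∃ k : FinKernel Y X, ∀ x, v x = ∑ y, k y x • ∑ x', g x' y • v x' := by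
  classical
  have heq := isSublinear_norm.garble_eq g v h
  let x0 : X := Classical.arbitrary X
  have hg : ∀ x y, ‖g x y • v x‖ = g x y * ‖v x‖ := fun x y => by
    rw [norm_smul, Real.norm_of_nonneg (stdSimplex.zero_le _ _)]
  set w : Y → E := fun y => ∑ x, g x y • v x with hw
  -- The reverse kernel returns `x` with the share of `‖w y‖` that `x` contributed; `heq` makes the
  -- shares sum to one. If `w y = 0`, every contribution is zero and any row will do.
  let k : FinKernel Y X := fun y =>
    if hy : w y = 0 then stdSimplex.vertex x0 else
      ⟨fun x => g x y * ‖v x‖ / ‖w y‖, fun x => by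
        have := stdSimplex.zero_le (g x) y
        positivity, by
        rw [← sum_div, ← heq y, div_self (norm_ne_zero_iff.2 hy)]⟩
  refine ⟨k, fun x => ?_⟩
  have key : ∀ y, k y x • w y = g x y • v x := by
    intro y
    have hs := norm_smul_sum_eq_of_norm_sum_eq (fun x => g x y • v x)
      (by simpa only [hg] using heq y) x
    by_cases hy : w y = 0
    · have h0 : ∑ x, g x y * ‖v x‖ = 0 := by rw [← heq y]; simpa [hw] using hy
      have h1 := (sum_eq_zero_iff_of_nonneg fun x _ =>
        mul_nonneg (stdSimplex.zero_le (g x) y) (norm_nonneg (v x))).1 h0 x (mem_univ x)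
      rw [← hg, norm_eq_zero] at h1
      rw [hy, h1, smul_zero]
    · have hk : k y x = g x y * ‖v x‖ / ‖w y‖ := by
        simp only [k, hy, dite_false]
        rfl
      have hn : ‖w y‖ ≠ 0 := norm_ne_zero_iff.2 hy
      change ‖g x y • v x‖ • w y = ‖w y‖ • g x y • v x at hs
      rw [hk, ← hg, div_eq_inv_mul, mul_smul, hs, smul_smul, inv_mul_cancel₀ hn, one_smul]
  rw [sum_congr rfl fun y _ => key y, ← sum_smul]
  simp

end StrictConvex

/-! ### Blackwell dominance through weighted columns -/

section Experiments

variable {Z Θ X : Type*} [Fintype Z] [Fintype X]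

/-- Weighting functions on `Z × Θ` by `ζ`, as vectors of a Euclidean space. -/
noncomputable def weighted (ζ : FinKernel Θ Z) : (Z × Θ → ℝ) →ₗ[ℝ] EuclideanSpace ℝ (Z × Θ) where
  toFun f := WithLp.toLp 2 fun s => ζ s.2 s.1 * f s
  map_add' f g := by ext; simp [mul_add]
  map_smul' r f := by ext; simp [mul_left_comm]

@[simp] theorem weighted_apply (ζ : FinKernel Θ Z) (f : Z × Θ → ℝ) (s : Z × Θ) :
    weighted ζ f s = ζ s.2 s.1 * f s := rfl

/-- The weights erase exactly the null states that `BlackwellDominates` ignores, so dominance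
becomes an identity between vectors. -/
theorem weighted_eq_iff (ζ : FinKernel Θ Z) (f g : Z × Θ → ℝ) :
    weighted ζ f = weighted ζ g ↔ ∀ θ z, 0 < ζ θ z → f (z, θ) = g (z, θ) := by
  constructor
  · intro h θ z hz
    have := congrArg (fun v : EuclideanSpace ℝ (Z × Θ) => v (z, θ)) h
    exact mul_left_cancel₀ hz.ne' this
  · intro h
    ext ⟨z, θ⟩
    rcases (stdSimplex.zero_le (ζ θ) z).eq_or_lt with h0 | h0
    · simp [← h0]
    · simp [h θ z h0]

/-- The weighted likelihood of a signal. -/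
noncomputable def signalCol (ζ : FinKernel Θ Z) (ξ : FinKernel (Z × Θ) X) (x : X) :
    EuclideanSpace ℝ (Z × Θ) :=
  weighted ζ fun s => ξ s x

theorem blackwellDominates_iff (ζ : FinKernel Θ Z) (ξ ξ' : FinKernel (Z × Θ) X) :
    BlackwellDominates ζ ξ ξ' ↔
      ∃ g : FinKernel X X, ∀ x, signalCol ζ ξ' x = ∑ x', g x' x • signalCol ζ ξ x' := by
  refine exists_congr fun g => forall_congr' fun x => ?_
  simp only [signalCol, ← map_smul, ← map_sum]
  rw [weighted_eq_iff]
  simp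

theorem BlackwellDominates.trans {ζ : FinKernel Θ Z} {ξ₁ ξ₂ ξ₃ : FinKernel (Z × Θ) X}
    (h₁ : BlackwellDominates ζ ξ₁ ξ₂) (h₂ : BlackwellDominates ζ ξ₂ ξ₃) :
    BlackwellDominates ζ ξ₁ ξ₃ := by
  obtain ⟨g, hg⟩ := h₁
  obtain ⟨k, hk⟩ := h₂
  refine ⟨g.comp k, fun x θ z hz => ?_⟩
  rw [hk x θ z hz]
  simp only [hg _ θ z hz, FinKernel.comp_apply, sum_mul, mul_sum]
  rw [sum_comm]
  exact sum_congr rfl fun _ _ => sum_congr rfl fun _ _ => by ring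

theorem BlackwellDominates.refl (ζ : FinKernel Θ Z) (ξ : FinKernel (Z × Θ) X) :
    BlackwellDominates ζ ξ ξ := by
  classical
  exact ⟨FinKernel.ofFun id, fun x θ z _ => by simp [FinKernel.ofFun_apply]⟩

/-- The experiment whose signal is `x₀` in every state. -/
noncomputable def constExperiment (Z Θ : Type*) (x₀ : X) : FinKernel (Z × Θ) X :=
  FinKernel.ofFun fun _ => x₀

theorem blackwellDominates_constExperiment (ζ : FinKernel Θ Z) (ξ : FinKernel (Z × Θ) X) (x₀ : X) :
    BlackwellDominates ζ ξ (constExperiment Z Θ x₀) :=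
  ⟨FinKernel.ofFun fun _ => x₀, fun x θ z _ => by
    simp [FinKernel.ofFun_apply, constExperiment]⟩

/-- The sum over signals of a functional of the weighted likelihoods. -/
noncomputable def signalSum (ζ : FinKernel Θ Z) (W : EuclideanSpace ℝ (Z × Θ) → ℝ)
    (ξ : FinKernel (Z × Θ) X) : ℝ :=
  ∑ x, W (signalCol ζ ξ x)

variable {ζ : FinKernel Θ Z} {W : EuclideanSpace ℝ (Z × Θ) → ℝ} {ξ ξ' : FinKernel (Z × Θ) X}

theorem IsSublinear.signalSum_le (hW : IsSublinear W) (h : BlackwellDominates ζ ξ ξ') :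
    signalSum ζ W ξ' ≤ signalSum ζ W ξ := by
  obtain ⟨g, hg⟩ := (blackwellDominates_iff ζ ξ ξ').1 h
  simp only [signalSum, hg]
  exact hW.garble_le g _

theorem IsSublinear.signalSum_constExperiment (hW : IsSublinear W) (x₀ : X) :
    signalSum ζ W (constExperiment Z Θ x₀) = W (weighted ζ 1) := by
  classical
  rw [signalSum, sum_eq_single x₀]
  · congr 1
    simp only [signalCol, constExperiment, FinKernel.ofFun_apply]
    rfl
  · intro x _ hx
    have : signalCol ζ (constExperiment Z Θ x₀) x = 0 := by
      simp only [signalCol, constExperiment, FinKernel.ofFun_apply, if_neg hx]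
      exact map_zero _
    rw [this]
    simpa using hW.smul 0 le_rfl 0
  · simp

theorem weighted_one_ne_zero [Nonempty Θ] : weighted ζ 1 ≠ 0 := by
  intro h
  obtain ⟨θ⟩ := ‹Nonempty Θ›
  have h0 : ∀ z, ζ θ z = 0 := fun z => by
    simpa using congrArg (fun v : EuclideanSpace ℝ (Z × Θ) => v (z, θ)) h
  simpa [h0] using stdSimplex.sum_eq_one (ζ θ)

variable [Fintype Θ]

/-- A measure of the informativeness of an experiment. -/
noncomputable def informativeness (ζ : FinKernel Θ Z) (ξ : FinKernel (Z × Θ) X) : ℝ :=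
  signalSum ζ (fun v => ‖v‖) ξ

/-- This is the strict monotonicity of `informativeness`, in contrapositive form. -/
theorem blackwellDominates_of_informativeness_le (h : BlackwellDominates ζ ξ ξ')
    (hle : informativeness ζ ξ ≤ informativeness ζ ξ') : BlackwellDominates ζ ξ' ξ := by
  obtain ⟨g, hg⟩ := (blackwellDominates_iff ζ ξ ξ').1 h
  rw [blackwellDominates_iff]
  rcases isEmpty_or_nonempty X with hX | hX
  · exact ⟨isEmptyElim, isEmptyElim⟩
  simp only [informativeness, signalSum, hg] at hle
  simp only [hg]
  exact exists_reverse_of_sum_norm_le g _ hle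

/-- For every gain `V` from information that strictly drops below that of `ξ`, there is a
monotone cost on the garblings of `ξ` such that `ξ` is optimal at the prescribed cost `k`. -/
theorem exists_monotone_cost [Nonempty Θ] [Nonempty X] (hW : IsSublinear W)
    (hξ : ∀ ξ', BlackwellDominates ζ ξ ξ' → signalSum ζ W ξ ≤ signalSum ζ W ξ' →
      BlackwellDominates ζ ξ' ξ) {k : ℝ} (hk0 : 0 ≤ k)
    (hk : k ≤ signalSum ζ W ξ - W (weighted ζ 1))
    (hk1 : k = 0 → signalSum ζ W ξ = W (weighted ζ 1)) :
    ∃ cost : {ξ' | BlackwellDominates ζ ξ ξ'} → ℝ≥0,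
      (∃ ξ', cost ξ' = 0) ∧
      (∀ ξ₁ ξ₂, (BlackwellDominates ζ ξ₁.1 ξ₂.1 → cost ξ₂ ≤ cost ξ₁) ∧
        (StrictlyBlackwellDominates ζ ξ₁.1 ξ₂.1 → cost ξ₂ < cost ξ₁)) ∧
      cost ⟨ξ, BlackwellDominates.refl ζ ξ⟩ = k ∧
      ∀ ξ', signalSum ζ W ξ'.1 - cost ξ' ≤ signalSum ζ W ξ - k := by
  classical
  set V : FinKernel (Z × Θ) X → ℝ := signalSum ζ W with hV
  set V0 : ℝ := W (weighted ζ 1) with hV0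
  set N0 : ℝ := ‖weighted ζ 1‖ with hN0
  have hN0pos : 0 < N0 := norm_pos_iff.2 weighted_one_ne_zero
  let x₀ : X := Classical.arbitrary X
  have hVc : V (constExperiment Z Θ x₀) = V0 := hW.signalSum_constExperiment x₀
  have hNc : informativeness ζ (constExperiment Z Θ x₀) = N0 :=
    isSublinear_norm.signalSum_constExperiment x₀
  have hVlow : ∀ ξ', V0 ≤ V ξ' := fun ξ' => by
    rw [← hVc]
    exact hW.signalSum_le (blackwellDominates_constExperiment ζ ξ' x₀)
  have hNlow : ∀ ξ' : FinKernel (Z × Θ) X, N0 ≤ informativeness ζ ξ' := fun ξ' => by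
    rw [← hNc]
    exact isSublinear_norm.signalSum_le (blackwellDominates_constExperiment ζ ξ' x₀)
  have hNpos : ∀ ξ' : FinKernel (Z × Θ) X, 0 < informativeness ζ ξ' := fun ξ' =>
    hN0pos.trans_le (hNlow ξ')
  have hVup : ∀ ξ', BlackwellDominates ζ ξ ξ' → V ξ' ≤ V ξ := fun ξ' h => hW.signalSum_le h
  set D0 : ℝ := V ξ - V0 with hD0
  have hD0k : k = 0 → D0 = 0 := fun h => by rw [hD0, hk1 h, sub_self]
  have hkD0 : 0 ≤ k / D0 ∧ k / D0 ≤ 1 :=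
    ⟨div_nonneg hk0 (hk0.trans hk), div_le_one_of_le₀ hk (hk0.trans hk)⟩
  -- `L` is the saving relative to `ξ`; the cost will be `k - L`. The value gap, scaled by `k / D0 ≤
  -- 1`, is monotone but perhaps not strictly. The factor `N0 / informativeness ≤ 1` adds strictness
  -- where the gap is positive and equals one at no information, so that the constant experiment is
  -- free.
  let L : FinKernel (Z × Θ) X → ℝ := fun ξ' =>
    k / D0 * (V ξ - V ξ') * (N0 / informativeness ζ ξ')
  have hq : ∀ ξ' : FinKernel (Z × Θ) X,
      0 < N0 / informativeness ζ ξ' ∧ N0 / informativeness ζ ξ' ≤ 1 := fun ξ' =>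
    ⟨div_pos hN0pos (hNpos ξ'), div_le_one_of_le₀ (hNlow ξ') (hNpos ξ').le⟩
  have hLk : ∀ ξ', BlackwellDominates ζ ξ ξ' → L ξ' ≤ k := fun ξ' h => by
    have h1 : k / D0 * (V ξ - V ξ') ≤ k := by
      rcases (hk0.trans hk).eq_or_lt with h0 | h0
      · rw [← h0, div_zero, zero_mul]; exact hk0
      · rw [div_mul_eq_mul_div, div_le_iff₀ h0]
        exact mul_le_mul_of_nonneg_left (sub_le_sub_left (hVlow ξ') _) hk0
    have h2 : 0 ≤ k / D0 * (V ξ - V ξ') := mul_nonneg hkD0.1 (sub_nonneg.2 (hVup ξ' h))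
    exact (mul_le_of_le_one_right h2 (hq ξ').2).trans h1
  have hLD : ∀ ξ', BlackwellDominates ζ ξ ξ' → L ξ' ≤ V ξ - V ξ' := fun ξ' h => by
    have h2 : 0 ≤ V ξ - V ξ' := sub_nonneg.2 (hVup ξ' h)
    exact (mul_le_of_le_one_right (mul_nonneg hkD0.1 h2) (hq ξ').2).trans
      (mul_le_of_le_one_left h2 hkD0.2)
  have hLmono : ∀ ξ₁ ξ₂, BlackwellDominates ζ ξ ξ₁ → BlackwellDominates ζ ξ₁ ξ₂ →
      L ξ₁ ≤ L ξ₂ := fun ξ₁ ξ₂ h₁ h₁₂ => by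
    have hA : V ξ₂ ≤ V ξ₁ := hW.signalSum_le h₁₂
    have hB : informativeness ζ ξ₂ ≤ informativeness ζ ξ₁ := isSublinear_norm.signalSum_le h₁₂
    have h2 : 0 ≤ V ξ - V ξ₁ := sub_nonneg.2 (hVup _ h₁)
    refine mul_le_mul (mul_le_mul_of_nonneg_left (by linarith) hkD0.1) ?_ (hq ξ₁).1.le
      (mul_nonneg hkD0.1 (by linarith))
    exact div_le_div_of_nonneg_left hN0pos.le (hNpos _) hB
  have hLstrict : ∀ ξ₁ ξ₂, BlackwellDominates ζ ξ ξ₁ → StrictlyBlackwellDominates ζ ξ₁ ξ₂ →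
      L ξ₁ < L ξ₂ := fun ξ₁ ξ₂ h₁ h₁₂ => by
    have hA : V ξ₂ ≤ V ξ₁ := hW.signalSum_le h₁₂.1
    have hB : informativeness ζ ξ₂ < informativeness ζ ξ₁ := by
      by_contra! hcon
      exact h₁₂.2 (blackwellDominates_of_informativeness_le h₁₂.1 hcon)
    have h2 : 0 ≤ V ξ - V ξ₁ := sub_nonneg.2 (hVup _ h₁)
    -- A zero gap would make `ξ₂` dominate `ξ`, hence `ξ₁`. In particular, the degenerate case `D0 =
    -- 0` has no strict comparisons.
    have hpos : 0 < V ξ - V ξ₂ := by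
      by_contra! hcon
      exact h₁₂.2 ((hξ ξ₂ (h₁.trans h₁₂.1) (by linarith)).trans h₁)
    have hD0pos : 0 < D0 := hpos.trans_le (by have := hVlow ξ₂; rw [hD0]; linarith)
    have hkpos : 0 < k := hk0.lt_of_ne fun h => hD0pos.ne' (hD0k h.symm)
    have hr : 0 < k / D0 := div_pos hkpos hD0pos
    refine mul_lt_mul' (mul_le_mul_of_nonneg_left (by linarith) hr.le) ?_ (hq ξ₁).1.le
      (mul_pos hr hpos)
    exact div_lt_div_of_pos_left hN0pos (hNpos _) hB
  refine ⟨fun ξ' => ⟨k - L ξ'.1, sub_nonneg.2 (hLk _ ξ'.2)⟩,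
    ⟨⟨constExperiment Z Θ x₀, blackwellDominates_constExperiment ζ ξ x₀⟩, ?_⟩,
    fun ξ₁ ξ₂ => ⟨fun h => ?_, fun h => ?_⟩, ?_, fun ξ' => ?_⟩
  · apply NNReal.coe_injective
    change k - k / D0 * (V ξ - V _) * (N0 / informativeness ζ _) = 0
    rw [hVc, hNc, div_self hN0pos.ne', mul_one]
    rcases eq_or_ne D0 0 with h0 | h0
    · rw [h0] at hk ⊢
      simp [le_antisymm hk hk0]
    · rw [← hD0, div_mul_cancel₀ _ h0, sub_self]
  · exact sub_le_sub_left (hLmono _ _ ξ₁.2 h) k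
  · exact sub_lt_sub_left (hLstrict _ _ ξ₁.2 h) k
  · change k - k / D0 * (V ξ - V ξ) * _ = k
    simp
  · have := hLD _ ξ'.2
    change V ξ'.1 - (k - L ξ'.1) ≤ V ξ - k
    linarith

end Experiments

theorem Fintype.sum_pi_prod_eq_prod_sum {ι : Type*} [Fintype ι] [DecidableEq ι] {X : ι → Type*}
    [∀ i, Fintype (X i)] (f : ∀ i, X i → ℝ) : ∑ x : ∀ i, X i, ∏ i, f i (x i) = ∏ i, ∑ x, f i x := by
  rw [Finset.prod_univ_sum, Fintype.piFinset_univ]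

/-! ### Action profiles and payoffs by recommendation -/

namespace BaseGame

variable {I : Type uI} {Θ : Type uT} {A : I → Type uA} [DecidableEq I]

section Profile

theorem profile_self (i : I) (c : A i) (am : OtherActions A i) : profile i c am i = c := by
  simp [profile, Equiv.piSplitAt]

theorem profile_of_ne (i : I) (c : A i) (am : OtherActions A i) (j : {j // j ≠ i}) :
    profile i c am j = am j := by
  simp [profile, Equiv.piSplitAt, j.2]

theorem update_profile (i : I) (c d : A i) (am : OtherActions A i) :
    Function.update (profile i c am) i d = profile i d am := by
  ext j
  rcases eq_or_ne j i with rfl | hj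
  · simp [profile_self]
  · rw [Function.update_of_ne hj, profile_of_ne i c am ⟨j, hj⟩, profile_of_ne i d am ⟨j, hj⟩]

theorem profile_surj (i : I) (a : ∀ j, A j) : profile i (a i) (fun j => a j) = a :=
  (Equiv.piSplitAt i A).symm_apply_apply a

variable [Fintype I]

theorem prod_profile (i : I) (f : ∀ j, A j → ℝ) (c : A i) (am : OtherActions A i) :
    ∏ j, f j (profile i c am j) = f i c * ∏ j : {j // j ≠ i}, f j (am j) := by
  rw [← mul_prod_erase univ _ (mem_univ i), profile_self]
  congr 1
  rw [prod_subtype (univ.erase i) (p := fun j => j ≠ i) (by simp)]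
  exact prod_congr rfl fun j _ => by rw [profile_of_ne]

theorem sum_profile [∀ i, Fintype (A i)] (i : I) (f : (∀ j, A j) → ℝ) :
    ∑ a, f a = ∑ c, ∑ am, f (profile i c am) := by
  rw [← (Equiv.piSplitAt i A).symm.sum_comp, Fintype.sum_prod_type]
  rfl

end Profile

variable [Fintype I] [Fintype Θ] [∀ i, Fintype (A i)]

section General

variable (G : BaseGame I Θ A) (p : (∀ i, A i) → Θ → ℝ)

/-- The expected payoff of player `i`, on the event that `c` is recommended to her, when she
takes `d`. -/
def recPayoff (i : I) (c d : A i) : ℝ :=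
  ∑ am : OtherActions A i, ∑ θ : Θ, G.u i (profile i d am) θ * p (profile i c am) θ

variable {G p}

theorem isObedient_iff : G.IsObedient p ↔
    ∀ (i : I) (c d : A i), G.recPayoff p i c d ≤ G.recPayoff p i c c := by
  refine forall_congr' fun i => forall_congr' fun c => forall_congr' fun d => ?_
  simp only [sub_mul, sum_sub_distrib, sub_nonneg]
  rfl

theorem grossValue_eq (i : I) : G.grossValue p i = ∑ c, G.recPayoff p i c c :=
  sum_profile i _

theorem sum_update_eq (i : I) (d : A i) :
    ∑ a, ∑ θ, G.u i (Function.update a i d) θ * p a θ = ∑ c, G.recPayoff p i c d := by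
  rw [sum_profile i]
  simp only [update_profile, recPayoff]

theorem le_uninformedValue [∀ i, Nonempty (A i)] (i : I) (d : A i) :
    ∑ c, G.recPayoff p i c d ≤ G.uninformedValue p i := by
  rw [← sum_update_eq]
  exact le_sup' (fun d => ∑ a, ∑ θ, G.u i (Function.update a i d) θ * p a θ) (mem_univ d)

theorem uninformedValue_le_iff [∀ i, Nonempty (A i)] (i : I) (r : ℝ) :
    G.uninformedValue p i ≤ r ↔ ∀ d, ∑ c, G.recPayoff p i c d ≤ r := by
  simp [uninformedValue, sum_update_eq]

theorem sum_mul_posterior (i : I) (c d : A i) :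
    ∑ am, ∑ θ, G.u i (profile i d am) θ * posterior p i c am θ
      = G.recPayoff p i c d / actionProb p i c := by
  simp only [posterior, recPayoff, sum_div, mul_div_assoc]

theorem mem_bestResponses_posterior {i : I} {c : A i} (hc : c ∈ actionSupp p i) (d : A i) :
    d ∈ G.bestResponses i (posterior p i c) ↔
      ∀ e, G.recPayoff p i c e ≤ G.recPayoff p i c d := by
  refine forall_congr' fun e => ?_
  rw [sum_mul_posterior, sum_mul_posterior]
  exact div_le_div_iff_of_pos_right hc

theorem actionProb_nonneg (hp : ∀ a θ, 0 ≤ p a θ) (i : I) (c : A i) : 0 ≤ actionProb p i c :=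
  sum_nonneg fun _ _ => sum_nonneg fun _ _ => hp _ _

theorem eq_zero_of_actionProb_eq_zero (hp : ∀ a θ, 0 ≤ p a θ) {i : I} {c : A i}
    (hc : actionProb p i c = 0) (am : OtherActions A i) (θ : Θ) : p (profile i c am) θ = 0 := by
  have h1 := (sum_eq_zero_iff_of_nonneg fun am _ => sum_nonneg fun θ _ => hp (profile i c am) θ).1 hc
    am (mem_univ _)
  exact (sum_eq_zero_iff_of_nonneg fun θ _ => hp _ θ).1 h1 θ (mem_univ _)

/-- This survives `actionProb = 0`, because `p` then vanishes on the whole slice. -/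
theorem eq_actionProb_mul_posterior (hp : ∀ a θ, 0 ≤ p a θ) (i : I) (c : A i)
    (am : OtherActions A i) (θ : Θ) :
    p (profile i c am) θ = actionProb p i c * posterior p i c am θ := by
  rcases eq_or_ne (actionProb p i c) 0 with h | h
  · rw [h, zero_mul, eq_zero_of_actionProb_eq_zero hp h]
  · rw [posterior, mul_div_cancel₀ _ h]

end General

/-! ### Outcomes and values of strategy profiles -/

section Strategies

variable {G : BaseGame I Θ A} {T : InformationTechnology.{uI, uT, uA, w} I Θ A}

/-- The probability that player `i` takes an action in the state `(z, θ)`. -/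
def actionKernel {i : I} (s : T.Strategy i) (st : T.Z × Θ) (c : A i) : ℝ :=
  ∑ x, s.2 x c * s.1.1 st x

omit [DecidableEq I] [Fintype I] in
theorem actionKernel_nonneg {i : I} (s : T.Strategy i) (st : T.Z × Θ) (c : A i) :
    0 ≤ actionKernel s st c :=
  sum_nonneg fun _ _ => mul_nonneg (stdSimplex.zero_le _ _) (stdSimplex.zero_le _ _)

omit [DecidableEq I] [Fintype I] in
theorem sum_actionKernel {i : I} (s : T.Strategy i) (st : T.Z × Θ) :
    ∑ c, actionKernel s st c = 1 := by
  simp only [actionKernel]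
  rw [sum_comm]
  simp [← sum_mul]

theorem outcome_eq (s : ∀ i, T.Strategy i) (a : ∀ i, A i) (θ : Θ) :
    G.outcome T s a θ =
      ∑ z, (∏ i, actionKernel (s i) (z, θ) (a i)) * (T.ζ θ z * G.prior θ) := by
  rw [outcome, sum_comm]
  refine sum_congr rfl fun z _ => ?_
  simp only [jointProb, mul_assoc, ← sum_mul]
  rw [Fintype.sum_pi_prod_eq_prod_sum fun i x => (s i).2 x (a i) * (s i).1.1 (z, θ) x]
  rfl

theorem value_eq (s : ∀ i, T.Strategy i) (i : I) :
    G.value T s i = G.grossValue (G.outcome T s) i - T.cost i (s i).1 := by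
  rw [value, grossValue]
  congr 1
  refine sum_congr rfl fun a _ => ?_
  simp only [outcome, mul_sum]
  rw [sum_congr rfl fun x _ => sum_comm, sum_comm]

variable (G) in
/-- The joint probability of the state and the actions of the players other than `i`. -/
def otherProb (s : ∀ i, T.Strategy i) (i : I) (am : OtherActions A i) (z : T.Z) (θ : Θ) : ℝ :=
  (∏ j : {j // j ≠ i}, actionKernel (s j) (z, θ) (am j)) * (T.ζ θ z * G.prior θ)

theorem outcome_profile (s : ∀ i, T.Strategy i) (i : I) (c : A i) (am : OtherActions A i) (θ : Θ) :
    G.outcome T s (profile i c am) θ =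
      ∑ z, actionKernel (s i) (z, θ) c * G.otherProb s i am z θ := by
  rw [outcome_eq]
  refine sum_congr rfl fun z _ => ?_
  rw [prod_profile i (fun j c => actionKernel (s j) (z, θ) c), otherProb, mul_assoc]

/-- Hence a deviator's gross payoff is linear in her own `actionKernel`, with fixed coefficients. -/
theorem otherProb_update (s : ∀ i, T.Strategy i) (i : I) (s' : T.Strategy i)
    (am : OtherActions A i) (z : T.Z) (θ : Θ) :
    G.otherProb (Function.update s i s') i am z θ = G.otherProb s i am z θ := by
  rw [otherProb, otherProb]
  congr 1
  exact prod_congr rfl fun j _ => by rw [Function.update_of_ne j.2]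

theorem value_update (s : ∀ i, T.Strategy i) (i : I) (s' : T.Strategy i) :
    G.value T (Function.update s i s') i =
      (∑ c, ∑ am, ∑ θ, G.u i (profile i c am) θ *
        ∑ z, actionKernel s' (z, θ) c * G.otherProb s i am z θ) - T.cost i s'.1 := by
  rw [value_eq, grossValue, sum_profile i]
  simp only [outcome_profile, otherProb_update, Function.update_self]

/-- The value of a deviation that transforms the player's actions by `m`. -/
theorem value_update_of_map [∀ i, DecidableEq (A i)] (s : ∀ i, T.Strategy i) (i : I)
    (s' : T.Strategy i) (m : A i → A i)
    (h : ∀ st c, actionKernel s' st c = ∑ d, if m d = c then actionKernel (s i) st d else 0) :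
    G.value T (Function.update s i s') i =
      (∑ d, G.recPayoff (G.outcome T s) i d (m d)) - T.cost i s'.1 := by
  rw [value_update]
  congr 1
  have h1 : ∀ c am θ, ∑ z, actionKernel s' (z, θ) c * G.otherProb s i am z θ =
      ∑ d, if m d = c then G.outcome T s (profile i d am) θ else 0 := by
    intro c am θ
    simp only [h, sum_mul, outcome_profile]
    rw [sum_comm]
    refine sum_congr rfl fun d _ => ?_
    split_ifs <;> simp
  simp only [h1, mul_sum]
  calc _ = ∑ c, ∑ d, if m d = c then G.recPayoff (G.outcome T s) i d c else 0 := by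
        refine sum_congr rfl fun c _ => ?_
        rw [sum_congr rfl fun am _ => sum_comm, sum_comm]
        refine sum_congr rfl fun d _ => ?_
        split_ifs <;> simp [recPayoff]
    _ = _ := by
        rw [sum_comm]
        simp

theorem isOutcome_outcome (s : ∀ i, T.Strategy i) : G.IsOutcome (G.outcome T s) := by
  have hm : ∀ θ, ∑ a, G.outcome T s a θ = G.prior θ := by
    intro θ
    simp only [outcome_eq]
    rw [sum_comm]
    simp only [← sum_mul]
    rw [sum_congr rfl fun z _ => by
      rw [Fintype.sum_pi_prod_eq_prod_sum fun i c => actionKernel (s i) (z, θ) c]]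
    simp [sum_actionKernel, ← sum_mul]
  refine ⟨fun a θ => ?_, ?_, hm⟩
  · rw [outcome_eq]
    exact sum_nonneg fun z _ => mul_nonneg (prod_nonneg fun i _ => actionKernel_nonneg _ _ _)
      (mul_nonneg (stdSimplex.zero_le _ _) (G.prior_pos θ).le)
  · rw [sum_comm]
    simp only [hm]
    exact G.prior_mem.2

end Strategies

end BaseGame

theorem Finset.sum_eq_add_add_sum_erase_erase {ι M : Type*} [Fintype ι] [DecidableEq ι]
    [AddCommMonoid M] {a b : ι} (h : a ≠ b) (f : ι → M) :
    ∑ d, f d = f a + (f b + ∑ d ∈ (univ.erase a).erase b, f d) := by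
  rw [add_sum_erase (univ.erase a) f (mem_erase.2 ⟨h.symm, mem_univ b⟩),
    add_sum_erase univ f (mem_univ a)]

/-! ### Necessity -/

namespace BaseGame

variable {I : Type uI} {Θ : Type uT} {A : I → Type uA} [DecidableEq I]
variable [Fintype I] [Fintype Θ] [∀ i, Fintype (A i)]
variable {G : BaseGame I Θ A} {T : InformationTechnology.{uI, uT, uA, w} I Θ A}

theorem IsEquilibrium.deviation_le [∀ i, DecidableEq (A i)] {s : ∀ i, T.Strategy i}
    (hs : G.IsEquilibrium T s) (i : I) (s' : T.Strategy i) (m : A i → A i)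
    (h : ∀ st c, actionKernel s' st c = ∑ d, if m d = c then actionKernel (s i) st d else 0) :
    (∑ d, G.recPayoff (G.outcome T s) i d (m d)) - T.cost i s'.1 ≤
      (∑ d, G.recPayoff (G.outcome T s) i d d) - T.cost i (s i).1 := by
  have h1 := hs i s'
  rwa [value_update_of_map s i s' m h, value_eq, grossValue_eq] at h1

/-- Keep the experiment and play `d` whenever the plan says `c`: the costs cancel and only the terms
for `c` differ. -/
theorem IsEquilibrium.isObedient {s : ∀ i, T.Strategy i} (hs : G.IsEquilibrium T s) :
    G.IsObedient (G.outcome T s) := by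
  classical
  rw [isObedient_iff]
  intro i c d
  have h := hs.deviation_le i ((s i).1, (s i).2.comp (FinKernel.ofFun (Function.update id c d)))
    (Function.update id c d) (by
      intro st e
      simp only [actionKernel, FinKernel.comp_apply, FinKernel.ofFun_apply, mul_ite, mul_one,
        mul_zero, sum_mul]
      rw [sum_comm]
      refine sum_congr rfl fun f _ => ?_
      by_cases hf : Function.update id c d f = e
      · simp [hf]
      · simp [hf, Ne.symm hf])
  rw [sub_le_sub_iff_right, ← add_sum_erase _ _ (mem_univ c), ← add_sum_erase _ _ (mem_univ c),
    Function.update_self, sum_congr rfl fun e he => by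
      rw [Function.update_of_ne (ne_of_mem_erase he), id]] at h
  linarith

/-- The deviation combines a free experiment with a constant action. -/
theorem IsEquilibrium.uninformedValue_le [∀ i, Nonempty (A i)] {s : ∀ i, T.Strategy i}
    (hs : G.IsEquilibrium T s) (i : I) :
    G.uninformedValue (G.outcome T s) i ≤ G.value T s i := by
  classical
  rw [uninformedValue_le_iff]
  intro d
  obtain ⟨ξ, hξ⟩ := T.exists_free i
  have h := hs.deviation_le i (ξ, FinKernel.ofFun fun _ => d) (fun _ => d) (by
    intro st e
    by_cases he : d = e
    · simp [actionKernel, FinKernel.ofFun_apply, he]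
      exact (sum_actionKernel _ _).symm
    · simp [actionKernel, FinKernel.ofFun_apply, he, Ne.symm he])
  rw [value_eq, grossValue_eq]
  simpa [hξ] using h

/-- An experiment without cost is uninformative. -/
theorem grossValue_le_uninformedValue [∀ i, Nonempty (A i)]
    (hT : T.IsRationalInattention) (s : ∀ i, T.Strategy i) (i : I) (h0 : T.cost i (s i).1 = 0) :
    G.grossValue (G.outcome T s) i ≤ G.uninformedValue (G.outcome T s) i := by
  classical
  set p := G.outcome T s with hp
  obtain ⟨x₀⟩ : Nonempty (T.X i) :=
    Fintype.card_pos_iff.1 ((Nat.zero_le _).trans_lt (T.card_action_lt i))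
  have hd := blackwellDominates_constExperiment T.ζ (s i).1.1 x₀
  -- Otherwise the constant experiment would be strictly cheaper than a free one.
  have hrev : BlackwellDominates T.ζ (constExperiment T.Z Θ x₀) (s i).1.1 := by
    by_contra hcon
    have h1 := ((hT i).2 (s i).1 ⟨_, (hT i).1 _ (s i).1.2 _ hd⟩).2 ⟨hd, hcon⟩
    rw [h0] at h1
    exact not_lt_zero h1
  obtain ⟨g, hg⟩ := hrev
  set k : A i → ℝ := fun c => ∑ x, (s i).2 x c * g x₀ x with hk
  have hκ : ∀ c θ z, 0 < T.ζ θ z → actionKernel (s i) (z, θ) c = k c := by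
    intro c θ z hz
    refine sum_congr rfl fun x _ => ?_
    rw [hg x θ z hz]
    simp [constExperiment, FinKernel.ofFun_apply]
  have hprod : ∀ c am θ, p (profile i c am) θ = k c * ∑ z, G.otherProb s i am z θ := by
    intro c am θ
    rw [hp, outcome_profile, mul_sum]
    refine sum_congr rfl fun z _ => ?_
    rcases (stdSimplex.zero_le (T.ζ θ) z).eq_or_lt with h | h
    · simp [otherProb, ← h]
    · rw [hκ c θ z h]
  have hksum : ∑ c, k c = 1 := by
    simp only [hk]
    rw [sum_comm]
    simp [← sum_mul]
  -- Her action is independent of everything payoff-relevant, so conditioning on it changes nothing.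
  have hQ : ∀ c, G.recPayoff p i c c = k c * ∑ d, G.recPayoff p i d c := by
    intro c
    simp only [recPayoff, hprod]
    have : ∀ d, (∑ am, ∑ θ, G.u i (profile i c am) θ * (k d * ∑ z, G.otherProb s i am z θ)) =
        k d * ∑ am, ∑ θ, G.u i (profile i c am) θ * ∑ z, G.otherProb s i am z θ := by
      intro d
      simp only [mul_sum]
      exact sum_congr rfl fun _ _ => sum_congr rfl fun _ _ => sum_congr rfl fun _ _ => by ring
    simp only [this, ← sum_mul, hksum, one_mul]
  rw [grossValue_eq]
  calc ∑ c, G.recPayoff p i c c = ∑ c, k c * ∑ d, G.recPayoff p i d c :=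
        sum_congr rfl fun c _ => hQ c
    _ ≤ ∑ c, k c * G.uninformedValue p i := sum_le_sum fun c _ =>
        mul_le_mul_of_nonneg_left (le_uninformedValue i c) (sum_nonneg fun x _ =>
          mul_nonneg (stdSimplex.zero_le _ _) (stdSimplex.zero_le _ _))
    _ = G.uninformedValue p i := by rw [← sum_mul, hksum, one_mul]

/-- The weighted likelihood of an action. -/
noncomputable def actionCol {i : I} (s : T.Strategy i) (c : A i) : EuclideanSpace ℝ (T.Z × Θ) :=
  weighted T.ζ fun st => actionKernel s st c

omit [DecidableEq I] [Fintype I] in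
theorem actionCol_eq {i : I} (s : T.Strategy i) (c : A i) :
    actionCol s c = ∑ x, s.2 x c • signalCol T.ζ s.1.1 x := by
  simp only [signalCol, ← map_smul, ← map_sum, actionCol]
  congr 1
  ext st
  simp [actionKernel]

omit [DecidableEq I] [Fintype I] in
theorem sum_norm_actionCol_le {i : I} (s : T.Strategy i) :
    ∑ c, ‖actionCol s c‖ ≤ informativeness T.ζ s.1.1 := by
  simp only [actionCol_eq]
  exact isSublinear_norm.garble_le s.2 _

/-- The slice of the outcome at an action is linear in its column, with coefficients that do not
depend on the action. Parallel columns thus give proportional slices, and normalization removes the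
factor. -/
theorem posterior_eq_of_sameRay (s : ∀ i, T.Strategy i) {i : I} {a b : A i}
    (ha : a ∈ actionSupp (G.outcome T s) i) (hb : b ∈ actionSupp (G.outcome T s) i)
    (h : SameRay ℝ (actionCol (s i) a) (actionCol (s i) b)) :
    posterior (G.outcome T s) i a = posterior (G.outcome T s) i b := by
  set p := G.outcome T s with hp
  have hlin : ∀ (c : A i) (am : OtherActions A i) (θ : Θ), p (profile i c am) θ =
      ∑ z, actionCol (s i) c (z, θ) *
        ((∏ j : {j // j ≠ i}, actionKernel (s j) (z, θ) (am j)) * G.prior θ) := by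
    intro c am θ
    rw [hp, outcome_profile]
    refine sum_congr rfl fun z _ => ?_
    rw [actionCol, weighted_apply, otherProb]
    ring
  have hne : ∀ c ∈ actionSupp p i, actionCol (s i) c ≠ 0 := by
    intro c hc h0
    have : actionProb p i c = 0 := by simp [actionProb, hlin, h0]
    exact (lt_of_lt_of_eq hc this).false
  obtain ⟨r, t, hr, ht, hrt⟩ := h.exists_pos (hne a ha) (hne b hb)
  have hpt : ∀ am θ, r * p (profile i a am) θ = t * p (profile i b am) θ := by
    intro am θ
    rw [hlin, hlin, mul_sum, mul_sum]
    refine sum_congr rfl fun z _ => ?_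
    have := congrArg (fun v : EuclideanSpace ℝ (T.Z × Θ) => v (z, θ)) hrt
    simp only [PiLp.smul_apply, smul_eq_mul] at this
    rw [← mul_assoc, this, mul_assoc]
  have hP : r * actionProb p i a = t * actionProb p i b := by
    simp only [actionProb, mul_sum, hpt]
  ext am θ
  rw [posterior, posterior, ← mul_div_mul_left _ _ hr.ne', hpt, hP, mul_div_mul_left _ _ ht.ne']

theorem IsEquilibrium.isSeparated (hT : T.IsRationalInattention) {s : ∀ i, T.Strategy i}
    (hs : G.IsEquilibrium T s) : G.IsSeparated (G.outcome T s) := by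
  classical
  intro i a ha b hb hab
  set p := G.outcome T s with hp
  by_contra hne
  obtain ⟨c, hca, hcb⟩ := Set.nonempty_iff_ne_empty.2 hne
  rw [mem_bestResponses_posterior ha] at hca
  rw [mem_bestResponses_posterior hb] at hcb
  have hneq : a ≠ b := fun h => hab (h ▸ rfl)
  obtain ⟨e⟩ : Nonempty (A i ↪ T.X i) :=
    Function.Embedding.nonempty_of_card_le (T.card_action_lt i).le
  have : Nonempty (A i) := ⟨a⟩
  -- The deviation merges `b` into `a` in the signal (`μ`) and then plays the common best response
  -- `c` on the merged signal (`n`).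
  let μ : A i → A i := Function.update id b a
  let n : A i → A i := Function.update id a c
  let κ : FinKernel (T.Z × Θ) (A i) := (s i).1.1.comp (s i).2
  have hκ : ∀ st d, κ st d = actionKernel (s i) st d := fun st d =>
    sum_congr rfl fun x _ => mul_comm _ _
  let η : FinKernel (T.Z × Θ) (T.X i) := κ.comp (FinKernel.ofFun (e ∘ μ))
  have hη : BlackwellDominates T.ζ (s i).1.1 η := by
    refine ⟨(s i).2.comp (FinKernel.ofFun (e ∘ μ)), fun x θ z _ => ?_⟩
    simp only [η, κ, FinKernel.comp_apply, sum_mul]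
    rw [sum_comm]
    exact sum_congr rfl fun _ _ => sum_congr rfl fun _ _ => by ring
  let ηf : T.feasible i := ⟨η, (hT i).1 _ (s i).1.2 _ hη⟩
  have hdev := hs.deviation_le i (ηf, FinKernel.ofFun (n ∘ Function.invFun e)) (n ∘ μ) (by
    intro st d
    simp only [actionKernel, ηf, η, FinKernel.comp_apply, FinKernel.ofFun_apply, hκ, mul_sum]
    rw [sum_comm]
    refine sum_congr rfl fun f _ => ?_
    rw [sum_eq_single (e (μ f))]
    · by_cases hf : n (μ f) = d
      · simp [hf, Function.leftInverse_invFun e.injective _]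
      · simp [hf, Ne.symm hf, Function.leftInverse_invFun e.injective _]
    · intro x _ hx
      simp [hx]
    · simp)
  have hob := isObedient_iff.1 hs.isObedient
  have hsum : ∑ d, G.recPayoff p i d ((n ∘ μ) d) = ∑ d, G.recPayoff p i d d := by
    refine sum_congr rfl fun d _ => ?_
    by_cases h1 : d = b
    · subst h1
      simp only [Function.comp, μ, n, Function.update_self]
      exact le_antisymm (hob i _ _) (hcb _)
    by_cases h2 : d = a
    · subst h2
      simp only [Function.comp, μ, n, Function.update_of_ne h1, id, Function.update_self]
      exact le_antisymm (hob i _ _) (hca _)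
    · simp [μ, n, h1, h2]
  -- The gross value is unchanged, so in equilibrium the pooled experiment cannot be cheaper.
  have hcost : T.cost i (s i).1 ≤ T.cost i ηf := by
    rw [hsum] at hdev
    have : (T.cost i (s i).1 : ℝ) ≤ T.cost i ηf := by linarith
    exact_mod_cast this
  have hrev : BlackwellDominates T.ζ η (s i).1.1 := by
    by_contra hcon
    exact (((hT i).2 (s i).1 ηf).2 ⟨hη, hcon⟩).not_ge hcost
  have hinf : informativeness T.ζ (s i).1.1 ≤ informativeness T.ζ η :=
    isSublinear_norm.signalSum_le hrev
  let v : A i → EuclideanSpace ℝ (T.Z × Θ) := actionCol (s i)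
  -- The columns after merging: `a` carries both, and `b` carries nothing.
  let w : A i → EuclideanSpace ℝ (T.Z × Θ) := Function.update (Function.update v a (v a + v b)) b 0
  have hcol : ∀ x, signalCol T.ζ η x = ∑ d, FinKernel.ofFun (e ∘ μ) d x • v d := by
    intro x
    simp only [signalCol, v, actionCol, ← map_smul, ← map_sum]
    congr 1
    ext st
    simp [η, FinKernel.comp_apply, hκ, mul_comm]
  have hcol' : ∀ x, signalCol T.ζ η x = ∑ d, FinKernel.ofFun e d x • w d := by
    intro x
    rw [hcol, sum_eq_add_add_sum_erase_erase hneq, sum_eq_add_add_sum_erase_erase hneq]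
    have hrest : ∀ d ∈ (univ.erase a).erase b,
        FinKernel.ofFun (e ∘ μ) d x • v d = FinKernel.ofFun e d x • w d := by
      intro d hd
      have h1 : d ≠ b := ne_of_mem_erase hd
      have h2 : d ≠ a := ne_of_mem_erase (mem_of_mem_erase hd)
      simp [FinKernel.ofFun_apply, w, μ, h1, h2]
    rw [sum_congr rfl hrest]
    simp [FinKernel.ofFun_apply, w, μ, hneq, ← add_assoc, smul_add]
  -- After cancelling the other actions this reads `‖v a‖ + ‖v b‖ ≤ ‖v a + v b‖`, equality in the
  -- triangle inequality.
  have hle : ∑ d, ‖v d‖ ≤ ∑ d, ‖w d‖ :=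
    (sum_norm_actionCol_le (s i)).trans (hinf.trans (by
      simp only [informativeness, signalSum, hcol']
      exact isSublinear_norm.garble_le (FinKernel.ofFun e) w))
  rw [sum_eq_add_add_sum_erase_erase hneq, sum_eq_add_add_sum_erase_erase hneq,
    sum_congr rfl fun d hd => show ‖w d‖ = ‖v d‖ by
      rw [show w d = v d by
        simp [w, ne_of_mem_erase hd, ne_of_mem_erase (mem_of_mem_erase hd)]]] at hle
  have hwa : w a = v a + v b := by simp [w, hneq]
  have hwb : w b = 0 := by simp [w]
  rw [hwa, hwb, norm_zero] at hle
  refine hab (posterior_eq_of_sameRay s ha hb (sameRay_iff_norm_add.2 ?_))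
  exact le_antisymm (norm_add_le _ _) (by linarith)

theorem Induces.isSeparatedBCE_and_value [∀ i, Nonempty (A i)] {p : (∀ i, A i) → Θ → ℝ}
    {v : I → ℝ} (hT : T.IsRationalInattention) (h : G.Induces T p v) :
    G.IsSeparatedBCE p ∧
      ∀ i, (v i = G.uninformedValue p i ∧ G.uninformedValue p i = G.grossValue p i) ∨
        v i ∈ Set.Ico (G.uninformedValue p i) (G.grossValue p i) := by
  obtain ⟨s, hs, rfl, rfl⟩ := h
  refine ⟨⟨⟨isOutcome_outcome s, hs.isObedient⟩, hs.isSeparated hT⟩, fun i => ?_⟩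
  have h1 := hs.uninformedValue_le i
  have h2 := value_eq (G := G) s i
  rcases eq_or_ne (T.cost i (s i).1) 0 with h0 | h0
  · left
    have h3 := grossValue_le_uninformedValue (G := G) hT s i h0
    rw [h0, NNReal.coe_zero, sub_zero] at h2
    exact ⟨le_antisymm (h2 ▸ h3) h1, le_antisymm (h2 ▸ h1) h3⟩
  · right
    have h3 : (0 : ℝ) < T.cost i (s i).1 := NNReal.coe_pos.2 (pos_iff_ne_zero.2 h0)
    exact ⟨h1, by linarith⟩

end BaseGame

/-! ### Sufficiency: preliminaries -/

theorem norm_sum_eq_of_subsingleton_ne_zero {ι E : Type*} [Fintype ι] [NormedAddCommGroup E]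
    (v : ι → E) (h : ∀ i j, v i ≠ 0 → v j ≠ 0 → i = j) : ‖∑ i, v i‖ = ∑ i, ‖v i‖ := by
  by_cases h0 : ∃ i, v i ≠ 0
  · obtain ⟨i, hi⟩ := h0
    have hz : ∀ j, j ≠ i → v j = 0 := fun j hj => by
      by_contra hv
      exact hj (h j i hv hi)
    rw [Fintype.sum_eq_single i hz, Fintype.sum_eq_single i fun j hj => by rw [hz j hj, norm_zero]]
  · push Not at h0
    simp [h0]

/-- A function on a product that is invariant under a kernel in each coordinate is invariant under
the product kernel. -/
theorem sum_prod_mul_eq_of_invariant {ι : Type*} [Fintype ι] [DecidableEq ι] {A : ι → Type*}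
    [∀ i, Fintype (A i)] (f : (∀ i, A i) → ℝ) (K : ∀ i, A i → A i → ℝ)
    (h : ∀ i a, ∑ d, K i d (a i) * f (Function.update a i d) = f a) (a : ∀ i, A i) :
    ∑ b, (∏ i, K i (b i) (a i)) * f b = f a := by
  classical
  -- Induct on the set of coordinates redrawn by `K`; the others are kept by the identity kernel.
  have key : ∀ (s : Finset ι) (a : ∀ i, A i),
      ∑ b, (∏ i, if i ∈ s then K i (b i) (a i) else if b i = a i then 1 else 0) * f b = f a := by
    intro s
    induction s using Finset.induction_on with
    | empty =>
      intro a
      rw [Fintype.sum_eq_single a]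
      · simp
      · intro b hb
        obtain ⟨i, hi⟩ := Function.ne_iff.1 hb
        rw [prod_eq_zero (mem_univ i) (by simp [hi]), zero_mul]
    | insert j s hj ih =>
      intro a
      rw [← h j a]
      refine Eq.trans ?_ (sum_congr rfl fun d _ =>
        congrArg (K j d (a j) * ·) (ih (Function.update a j d)))
      simp only [mul_sum]
      rw [sum_comm]
      refine sum_congr rfl fun b _ => ?_
      have h1 : ∀ d, (∏ i, if i ∈ s then K i (b i) (Function.update a j d i)
          else if b i = Function.update a j d i then 1 else 0) =
          (if b j = d then 1 else 0) * ∏ i ∈ univ.erase j,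
            if i ∈ s then K i (b i) (a i) else if b i = a i then (1 : ℝ) else 0 := by
        intro d
        rw [← mul_prod_erase univ _ (mem_univ j)]
        simp only [hj, if_false, Function.update_self]
        congr 1
        exact prod_congr rfl fun i hi => by rw [Function.update_of_ne (ne_of_mem_erase hi)]
      simp only [h1]
      rw [← mul_prod_erase univ _ (mem_univ j), if_pos (mem_insert_self j s)]
      have h2 : ∀ i ∈ univ.erase j, (if i ∈ insert j s then K i (b i) (a i)
          else if b i = a i then (1 : ℝ) else 0) =
          if i ∈ s then K i (b i) (a i) else if b i = a i then 1 else 0 := fun i hi => by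
        simp [mem_insert, ne_of_mem_erase hi]
      rw [prod_congr rfl h2]
      simp [mul_assoc]
  simpa using key univ a

namespace BaseGame

variable {I : Type uI} {Θ : Type uT} {A : I → Type uA} [DecidableEq I]
variable [Fintype I] [Fintype Θ] [∀ i, Fintype (A i)]
variable {G : BaseGame I Θ A} {p : (∀ i, A i) → Θ → ℝ}

/-! ### Posterior classes and redrawing -/

section Representative

/-- A representative of the actions with the same posterior as a given action. -/
noncomputable def posteriorRep (p : (∀ i, A i) → Θ → ℝ) (i : I) (a : A i) : A i :=
  haveI : Nonempty (A i) := ⟨a⟩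
  Function.invFun (posterior p i) (posterior p i a)

theorem posterior_posteriorRep (i : I) (a : A i) :
    posterior p i (posteriorRep p i a) = posterior p i a :=
  haveI : Nonempty (A i) := ⟨a⟩
  Function.invFun_eq (f := posterior p i) ⟨a, rfl⟩

theorem posteriorRep_eq_iff {i : I} {a b : A i} :
    posteriorRep p i a = posteriorRep p i b ↔ posterior p i a = posterior p i b := by
  constructor
  · intro h
    rw [← posterior_posteriorRep, h, posterior_posteriorRep]
  · intro h
    simp only [posteriorRep, h]

/-- The representative is obedient at its own posterior, which is also that of `d`. If `d` has
probability zero, both sides vanish. -/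
theorem recPayoff_posteriorRep (hp : ∀ a θ, 0 ≤ p a θ) (hob : G.IsObedient p) (i : I) (d : A i) :
    G.recPayoff p i d (posteriorRep p i d) = G.recPayoff p i d d := by
  rw [isObedient_iff] at hob
  set r := posteriorRep p i d
  have hr : posterior p i r = posterior p i d := posterior_posteriorRep i d
  have hQ : ∀ c e, G.recPayoff p i c e =
      actionProb p i c * ∑ am, ∑ θ, G.u i (profile i e am) θ * posterior p i c am θ := by
    intro c e
    simp only [recPayoff, eq_actionProb_mul_posterior hp, mul_sum]
    exact sum_congr rfl fun _ _ => sum_congr rfl fun _ _ => by ring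
  rcases (actionProb_nonneg hp i d).eq_or_lt with h | h
  · simp [hQ d, ← h]
  · have hrpos : 0 < actionProb p i r := by
      -- Division by zero makes the posterior of a null action the zero function, so null actions
      -- never share a class with actions of positive probability.
      refine (actionProb_nonneg hp i r).lt_of_ne fun h0 => ?_
      have hz : posterior p i d = 0 := by
        rw [← hr]
        ext am θ
        simp [posterior, ← h0]
      have : actionProb p i d = 0 := by
        rw [actionProb]
        simp [eq_actionProb_mul_posterior hp, hz]
      exact h.ne' this
    refine le_antisymm (hob i d r) ?_
    have h1 : r ∈ G.bestResponses i (posterior p i r) :=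
      (mem_bestResponses_posterior hrpos r).2 (hob i r)
    rw [hr] at h1
    exact (mem_bestResponses_posterior h r).1 h1 d

/-- There is an action plan that draws each action with its probability conditional on the
representative of the action, so that `p` is invariant under redrawing the action. -/
theorem exists_redraw (hp : ∀ a θ, 0 ≤ p a θ) {i : I} [Nonempty (A i)] {X : Type*} [Fintype X]
    (e : A i ↪ X) : ∃ σ : FinKernel X (A i), ∀ (c : A i) (am : OtherActions A i) (θ : Θ),
      ∑ d, σ (e (posteriorRep p i d)) c * p (profile i d am) θ = p (profile i c am) θ := by
  classical
  let P : A i → ℝ := fun r => ∑ d, if posteriorRep p i d = r then actionProb p i d else 0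
  have hnn : ∀ d r, 0 ≤ if posteriorRep p i d = r then actionProb p i d else 0 := fun d r => by
    split_ifs
    exacts [actionProb_nonneg hp i d, le_rfl]
  let σ : FinKernel X (A i) := fun x =>
    if h : 0 < P (Function.invFun e x) then
      ⟨fun c => (if posteriorRep p i c = Function.invFun e x then actionProb p i c else 0) /
        P (Function.invFun e x), fun c => div_nonneg (hnn _ _) h.le, by
          rw [← sum_div]
          exact div_self h.ne'⟩
    else stdSimplex.vertex (Classical.arbitrary _)
  have hσ : ∀ r c, 0 < P r →
      σ (e r) c = (if posteriorRep p i c = r then actionProb p i c else 0) / P r := by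
    intro r c h
    have he : Function.invFun e (e r) = r := Function.leftInverse_invFun e.injective r
    simp only [σ, he, h, dite_true]
    rfl
  refine ⟨σ, fun c am θ => ?_⟩
  -- Within a class, slices of `p` are multiples of one posterior, so the probabilities of `c` and
  -- `d` can be exchanged.
  have hterm : ∀ d, σ (e (posteriorRep p i d)) c * p (profile i d am) θ =
      p (profile i c am) θ / P (posteriorRep p i c) *
        if posteriorRep p i d = posteriorRep p i c then actionProb p i d else 0 := by
    intro d
    have hdP : actionProb p i d ≤ P (posteriorRep p i d) := by
      simpa using single_le_sum (fun d' _ => hnn d' (posteriorRep p i d)) (mem_univ d)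
    rcases (actionProb_nonneg hp i d).eq_or_lt with h | h
    · rw [eq_zero_of_actionProb_eq_zero hp h.symm, ← h]
      simp
    · rw [hσ _ _ (h.trans_le hdP)]
      by_cases hcd : posteriorRep p i d = posteriorRep p i c
      · rw [if_pos hcd, if_pos hcd.symm, hcd, eq_actionProb_mul_posterior hp i d,
          eq_actionProb_mul_posterior hp i c, posteriorRep_eq_iff.1 hcd]
        ring
      · rw [if_neg hcd, if_neg (Ne.symm hcd)]
        simp
  rw [sum_congr rfl fun d _ => hterm d, ← mul_sum]
  change p (profile i c am) θ / P (posteriorRep p i c) * P (posteriorRep p i c) = _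
  rcases (actionProb_nonneg hp i c).eq_or_lt with h | h
  · rw [eq_zero_of_actionProb_eq_zero hp h.symm]
    simp
  · have hcP : actionProb p i c ≤ P (posteriorRep p i c) := by
      simpa using single_le_sum (fun d' _ => hnn d' (posteriorRep p i c)) (mem_univ c)
    rw [div_mul_cancel₀ _ (h.trans_le hcP).ne']

end Representative

/-! ### The recommendation experiment and its value -/

section Construction

variable {Z : Type w} [Fintype Z] (eZ : Z ≃ ∀ i, A i)

/-- The distribution of recommended action profiles conditional on the payoff state. -/
noncomputable def recKernel (hp : G.IsOutcome p) : FinKernel Θ Z := fun θ =>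
  ⟨fun z => p (eZ z) θ / G.prior θ, fun z => div_nonneg (hp.1 _ _) (G.prior_pos θ).le, by
    rw [← sum_div, eZ.sum_comp fun a => p a θ, hp.2.2, div_self (G.prior_pos θ).ne']⟩

theorem recKernel_mul_prior (hp : G.IsOutcome p) (θ : Θ) (z : Z) :
    recKernel eZ hp θ z * G.prior θ = p (eZ z) θ :=
  div_mul_cancel₀ _ (G.prior_pos θ).ne'

variable (p) in
/-- The experiment that reveals the representative of the recommended action. -/
noncomputable def recExperiment {i : I} {X : Type*} [Fintype X] (e : A i ↪ X) :
    FinKernel (Z × Θ) X :=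
  FinKernel.ofFun fun st => e (posteriorRep p i (eZ st.1 i))

open scoped Classical in
/-- The weighted likelihood of a recommendation. -/
noncomputable def recCol (hp : G.IsOutcome p) (i : I) (d : A i) : EuclideanSpace ℝ (Z × Θ) :=
  weighted (recKernel eZ hp) fun st => if eZ st.1 i = d then 1 else 0

theorem signalCol_recExperiment (hp : G.IsOutcome p) {i : I} {X : Type*} [Fintype X]
    (e : A i ↪ X) (x : X) :
    signalCol (recKernel eZ hp) (recExperiment p eZ e) x =
      ∑ d, FinKernel.ofFun (fun d => e (posteriorRep p i d)) d x • recCol eZ hp i d := by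
  classical
  simp only [signalCol, recCol, ← map_smul, ← map_sum]
  congr 1
  ext st
  simp only [Finset.sum_apply, Pi.smul_apply, smul_eq_mul, FinKernel.ofFun_apply, recExperiment]
  simp

theorem sum_recCol (hp : G.IsOutcome p) (i : I) :
    ∑ d, recCol eZ hp i d = weighted (recKernel eZ hp) 1 := by
  classical
  simp only [recCol, ← map_sum]
  congr 1
  ext st
  simp

theorem recCol_eq_zero (hp : G.IsOutcome p) {i : I} {d : A i} (hd : d ∉ actionSupp p i) :
    recCol eZ hp i d = 0 := by
  classical
  have h0 : actionProb p i d = 0 :=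
    le_antisymm (not_lt.1 hd) (actionProb_nonneg hp.1 i d)
  ext ⟨z, θ⟩
  rw [recCol, weighted_apply]
  by_cases hz : eZ z i = d
  · have : p (eZ z) θ = 0 := by
      rw [← profile_surj i (eZ z)]
      exact eq_zero_of_actionProb_eq_zero hp.1 (by rw [hz, h0]) _ _
    have hk : recKernel eZ hp θ z = 0 := by
      change p (eZ z) θ / G.prior θ = 0
      rw [this, zero_div]
    simp [hk]
  · simp [hz]

variable (G) in
/-- The payoff of player `i` from an action, as a functional of weighted likelihoods. -/
noncomputable def actionPayoff (i : I) (d : A i) : EuclideanSpace ℝ (Z × Θ) →ₗ[ℝ] ℝ where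
  toFun v := ∑ z, ∑ θ, G.u i (Function.update (eZ z) i d) θ * G.prior θ * v (z, θ)
  map_add' v w := by simp [mul_add, sum_add_distrib]
  map_smul' r v := by simp [mul_sum, mul_left_comm]

theorem actionPayoff_recCol (hp : G.IsOutcome p) (i : I) (d b : A i) :
    actionPayoff G eZ i b (recCol eZ hp i d) = G.recPayoff p i d b := by
  classical
  have h1 : ∀ z θ, G.u i (Function.update (eZ z) i b) θ * G.prior θ * recCol eZ hp i d (z, θ) =
      if eZ z i = d then G.u i (Function.update (eZ z) i b) θ * p (eZ z) θ else 0 := by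
    intro z θ
    rw [recCol, weighted_apply, ← recKernel_mul_prior eZ hp]
    split_ifs <;> ring
  change ∑ z, ∑ θ, G.u i (Function.update (eZ z) i b) θ * G.prior θ * recCol eZ hp i d (z, θ) = _
  simp only [h1]
  rw [eZ.sum_comp fun a => ∑ θ, if a i = d then G.u i (Function.update a i b) θ * p a θ else 0,
    sum_profile i, Fintype.sum_eq_single d]
  · simp [profile_self, update_profile, recPayoff]
  · intro c hc
    simp [profile_self, hc]

variable [∀ i, Nonempty (A i)]

variable (G) in
/-- The maximal payoff of player `i`, as a functional of weighted likelihoods. -/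
noncomputable def maxPayoff (i : I) (v : EuclideanSpace ℝ (Z × Θ)) : ℝ :=
  univ.sup' univ_nonempty fun d => actionPayoff G eZ i d v

omit [Fintype I] in
theorem isSublinear_maxPayoff (i : I) : IsSublinear (maxPayoff G eZ i) :=
  isSublinear_sup' _

/-- With this, the value of the constant experiment in `exists_monotone_cost` is the uninformed
value. -/
theorem maxPayoff_one (hp : G.IsOutcome p) (i : I) :
    maxPayoff G eZ i (weighted (recKernel eZ hp) 1) = G.uninformedValue p i := by
  simp only [maxPayoff, uninformedValue, ← sum_recCol eZ hp i, map_sum, actionPayoff_recCol,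
    sum_update_eq]

theorem maxPayoff_recCol (hp : G.IsOutcome p) (hob : G.IsObedient p) (i : I) (d : A i) :
    maxPayoff G eZ i (recCol eZ hp i d) = G.recPayoff p i d d := by
  simp only [maxPayoff, actionPayoff_recCol]
  exact le_antisymm (sup'_le _ _ fun b _ => isObedient_iff.1 hob i d b)
    (le_sup' (fun b => G.recPayoff p i d b) (mem_univ d))

variable {i : I} {X : Type w} [Fintype X] (e : A i ↪ X)

/-- Revealing only the class garbles the recommendations, hence `≤`. Conversely, playing the
representative named by the signal already attains the gross value. -/
theorem signalSum_recExperiment (hp : G.IsOutcome p) (hob : G.IsObedient p) :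
    signalSum (recKernel eZ hp) (maxPayoff G eZ i) (recExperiment p eZ e) = G.grossValue p i := by
  classical
  rw [grossValue_eq]
  refine le_antisymm ?_ ?_
  · simp only [signalSum, signalCol_recExperiment, ← maxPayoff_recCol eZ hp hob]
    exact (isSublinear_maxPayoff eZ i).garble_le _ _
  · calc ∑ d, G.recPayoff p i d d
        = ∑ x, ∑ d, FinKernel.ofFun (fun d => e (posteriorRep p i d)) d x *
            G.recPayoff p i d (Function.invFun e x) := by
          rw [sum_comm]
          refine sum_congr rfl fun d _ => ?_
          simp only [FinKernel.ofFun_apply, ite_mul, one_mul, zero_mul, sum_ite_eq', mem_univ,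
            if_true]
          rw [Function.leftInverse_invFun e.injective, recPayoff_posteriorRep hp.1 hob]
      _ = ∑ x, actionPayoff G eZ i (Function.invFun e x)
            (signalCol (recKernel eZ hp) (recExperiment p eZ e) x) := by
          simp [signalCol_recExperiment, actionPayoff_recCol]
      _ ≤ _ := sum_le_sum fun x _ =>
          le_sup' (fun b => actionPayoff G eZ i b _) (mem_univ _)

omit [∀ i, Nonempty (A i)] in
theorem signalCol_of_garbling (hp : G.IsOutcome p) {ξ : FinKernel (Z × Θ) X} {g : FinKernel X X}
    (hg : ∀ x, signalCol (recKernel eZ hp) ξ x =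
      ∑ x', g x' x • signalCol (recKernel eZ hp) (recExperiment p eZ e) x') (x : X) :
    signalCol (recKernel eZ hp) ξ x =
      ∑ d, g (e (posteriorRep p i d)) x • recCol eZ hp i d := by
  classical
  rw [hg]
  simp only [signalCol_recExperiment, smul_sum, smul_smul]
  rw [sum_comm]
  refine sum_congr rfl fun d _ => ?_
  rw [← sum_smul]
  simp [FinKernel.ofFun_apply]

/-- Under separation, a garbling of the recommendations that is as valuable is as informative. -/
theorem blackwellDominates_recExperiment (hp : G.IsOutcome p) (hob : G.IsObedient p)
    (hsep : G.IsSeparated p) (ξ : FinKernel (Z × Θ) X)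
    (hξ : BlackwellDominates (recKernel eZ hp) (recExperiment p eZ e) ξ)
    (hle : signalSum (recKernel eZ hp) (maxPayoff G eZ i) (recExperiment p eZ e) ≤
      signalSum (recKernel eZ hp) (maxPayoff G eZ i) ξ) :
    BlackwellDominates (recKernel eZ hp) ξ (recExperiment p eZ e) := by
  classical
  set ζ := recKernel eZ hp
  obtain ⟨g, hg⟩ := (blackwellDominates_iff _ _ _).1 hξ
  have hg' := signalCol_of_garbling eZ e hp hg
  let k : FinKernel (A i) X := fun d => g (e (posteriorRep p i d))
  have hadd := (isSublinear_maxPayoff (G := G) eZ i).garble_eq k (recCol eZ hp i) (by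
    rw [signalSum_recExperiment eZ e hp hob, grossValue_eq] at hle
    simp only [maxPayoff_recCol eZ hp hob]
    simpa only [signalSum, ζ, hg'] using hle)
  -- No value is lost at `y`, so an optimal `b` for the pooled column is a best response to every
  -- recommendation pooled there. Separation then leaves a single class.
  have hone : ∀ y d d', 0 < k d y → 0 < k d' y → d ∈ actionSupp p i → d' ∈ actionSupp p i →
      posteriorRep p i d = posteriorRep p i d' := by
    intro y d d' hd hd' hs hs'
    obtain ⟨b, -, hb⟩ := exists_mem_eq_sup' univ_nonempty
      fun b => actionPayoff G eZ i b (∑ d, k d y • recCol eZ hp i d)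
    have h1 : ∑ d, k d y * G.recPayoff p i d b = ∑ d, k d y * G.recPayoff p i d d := by
      have h2 := hadd y
      rw [maxPayoff, hb] at h2
      simpa [maxPayoff_recCol eZ hp hob, actionPayoff_recCol] using h2
    have h3 := (sum_eq_sum_iff_of_le fun d _ => mul_le_mul_of_nonneg_left
      (isObedient_iff.1 hob i d b) (stdSimplex.zero_le (k d) y)).1 h1
    have hbr : ∀ d, 0 < k d y → d ∈ actionSupp p i → b ∈ G.bestResponses i (posterior p i d) := by
      intro d hd hs
      rw [mem_bestResponses_posterior hs]
      intro c
      rw [mul_left_cancel₀ hd.ne' (h3 d (mem_univ d))]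
      exact isObedient_iff.1 hob i d c
    rw [posteriorRep_eq_iff]
    by_contra hne
    exact Set.notMem_empty b (hsep i d hs d' hs' hne ▸ ⟨hbr d hd hs, hbr d' hd' hs'⟩)
  -- Each signal of `ξ` now mixes at most one nonzero column, so norms add without loss.
  refine blackwellDominates_of_informativeness_le hξ ?_
  rw [informativeness, informativeness, signalSum, signalSum, ← g.sum_sum_mul]
  refine sum_le_sum fun y _ => ?_
  rw [hg]
  have hsupp : ∀ x, g x y • signalCol ζ (recExperiment p eZ e) x ≠ 0 →
      ∃ d ∈ actionSupp p i, x = e (posteriorRep p i d) ∧ 0 < k d y := by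
    intro x hx
    obtain ⟨hx1, hx2⟩ := smul_ne_zero_iff.1 hx
    rw [signalCol_recExperiment] at hx2
    obtain ⟨d, -, hd⟩ := exists_ne_zero_of_sum_ne_zero hx2
    obtain ⟨hd1, hd2⟩ := smul_ne_zero_iff.1 hd
    rw [FinKernel.ofFun_apply] at hd1
    have hxd : x = e (posteriorRep p i d) := by
      by_contra hne
      exact hd1 (if_neg hne)
    refine ⟨d, ?_, hxd, ?_⟩
    · by_contra hds
      exact hd2 (recCol_eq_zero eZ hp hds)
    · change 0 < g (e (posteriorRep p i d)) y
      rw [← hxd]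
      exact (stdSimplex.zero_le _ _).lt_of_ne (Ne.symm hx1)
  rw [norm_sum_eq_of_subsingleton_ne_zero]
  · refine le_of_eq (sum_congr rfl fun x _ => ?_)
    rw [norm_smul, Real.norm_of_nonneg (stdSimplex.zero_le _ _)]
  · intro x x' hx hx'
    obtain ⟨d, hd, rfl, hk⟩ := hsupp x hx
    obtain ⟨d', hd', rfl, hk'⟩ := hsupp x' hx'
    rw [hone y d d' hk hk' hd hd']

end Construction

end BaseGame

namespace BaseGame

variable {I : Type uI} {Θ : Type uT} {A : I → Type uA} [DecidableEq I]
variable [Fintype I] [Fintype Θ] [∀ i, Fintype (A i)]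
variable {G : BaseGame I Θ A} {p : (∀ i, A i) → Θ → ℝ}

/-! ### Behaviour under recommendations -/

section Recommendations

variable {T : InformationTechnology.{uI, uT, uA, w} I Θ A} (eZ : T.Z ≃ ∀ i, A i)
  (e : ∀ i, A i ↪ T.X i)

variable (p) in
/-- Every player learns the representative of her recommended action and redraws the action. -/
structure IsRecommendation (s : ∀ i, T.Strategy i) : Prop where
  experiment : ∀ i, (s i).1.1 = recExperiment p eZ (e i)
  redraw : ∀ i (c : A i) (am : OtherActions A i) (θ : Θ),
    ∑ d, (s i).2 (e i (posteriorRep p i d)) c * p (profile i d am) θ = p (profile i c am) θ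

variable {eZ e} {s : ∀ i, T.Strategy i} (hs : IsRecommendation p eZ e s)
include hs

theorem IsRecommendation.actionKernel_eq (i : I) (z : T.Z) (θ : Θ) (c : A i) :
    actionKernel (s i) (z, θ) c = (s i).2 (e i (posteriorRep p i (eZ z i))) c := by
  classical
  simp [actionKernel, hs.experiment, recExperiment, FinKernel.ofFun_apply]

theorem IsRecommendation.redraw_update (i : I) (θ : Θ) (a : ∀ i, A i) :
    ∑ d, (s i).2 (e i (posteriorRep p i d)) (a i) * p (Function.update a i d) θ = p a θ := by
  have h := hs.redraw i (a i) (fun j => a j) θ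
  rw [profile_surj] at h
  rw [← h]
  refine sum_congr rfl fun d _ => ?_
  rw [← update_profile i (a i) d, profile_surj]

theorem IsRecommendation.outcome_eq {hp : G.IsOutcome p} (hζ : T.ζ = recKernel eZ hp) :
    G.outcome T s = p := by
  ext a θ
  rw [BaseGame.outcome_eq]
  simp only [hζ, recKernel_mul_prior, hs.actionKernel_eq]
  rw [eZ.sum_comp fun b => (∏ i, (s i).2 (e i (posteriorRep p i (b i))) (a i)) * p b θ]
  exact sum_prod_mul_eq_of_invariant (fun b => p b θ)
    (fun i d c => (s i).2 (e i (posteriorRep p i d)) c) (fun i a => hs.redraw_update i θ a) a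

open scoped Classical in
theorem IsRecommendation.sum_otherProb {hp : G.IsOutcome p} (hζ : T.ζ = recKernel eZ hp) (i : I)
    (d : A i) (am : OtherActions A i) (θ : Θ) :
    ∑ z, (if eZ z i = d then 1 else 0) * G.otherProb s i am z θ = p (profile i d am) θ := by
  simp only [otherProb, hζ, recKernel_mul_prior, hs.actionKernel_eq]
  rw [eZ.sum_comp fun b => (if b i = d then (1 : ℝ) else 0) *
    ((∏ j : {j // j ≠ i}, (s j).2 (e j (posteriorRep p j (b j))) (am j)) * p b θ)]
  -- Player `i`'s recommendation is held fixed by the identity kernel while the others redraw.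
  let K : ∀ j, A j → A j → ℝ := Function.update
    (fun j d c => (s j).2 (e j (posteriorRep p j d)) c) i fun d c => if d = c then 1 else 0
  rw [← sum_prod_mul_eq_of_invariant (fun b => p b θ) K]
  · refine sum_congr rfl fun b _ => ?_
    rw [prod_profile i (fun j c => K j (b j) c), ← mul_assoc]
    congr 2
    · simp [K]
    · exact prod_congr rfl fun j _ => by simp [K, j.2]
  · intro j a
    rcases eq_or_ne j i with rfl | hj
    · simp [K]
    · simp only [K, Function.update_of_ne hj]
      exact hs.redraw_update j θ a

/-- The deviator's signal depends on the state only through her recommendation, and by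
`sum_otherProb` the others' redraws preserve its joint law with their actions and `θ`. Her gross
payoff is therefore at most the sum over signals of the maximal payoff. -/
theorem IsRecommendation.value_update_le [∀ i, Nonempty (A i)] {hp : G.IsOutcome p}
    (hζ : T.ζ = recKernel eZ hp) (i : I) (s' : T.Strategy i)
    (hd : BlackwellDominates T.ζ (recExperiment p eZ (e i)) s'.1.1) :
    G.value T (Function.update s i s') i ≤
      signalSum T.ζ (maxPayoff G eZ i) s'.1.1 - T.cost i s'.1 := by
  classical
  rw [value_update]
  refine sub_le_sub_right ?_ _
  obtain ⟨g, hg⟩ := hd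
  let ρ : A i → A i → ℝ := fun d c => ∑ x, s'.2 x c * g (e i (posteriorRep p i d)) x
  have hρ : ∀ c am θ, ∑ z, actionKernel s' (z, θ) c * G.otherProb s i am z θ =
      ∑ d, ρ d c * p (profile i d am) θ := by
    intro c am θ
    simp only [← hs.sum_otherProb hζ, mul_sum]
    rw [sum_comm]
    refine sum_congr rfl fun z _ => ?_
    rcases (stdSimplex.zero_le (T.ζ θ) z).eq_or_lt with h | h
    · simp [otherProb, ← h]
    · have : actionKernel s' (z, θ) c = ρ (eZ z i) c := by
        refine sum_congr rfl fun x _ => ?_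
        rw [hg x θ z h]
        simp [recExperiment, FinKernel.ofFun_apply]
      simp [this]
  have hcol : ∀ x c, actionPayoff G eZ i c (signalCol T.ζ s'.1.1 x) =
      ∑ d, g (e i (posteriorRep p i d)) x * G.recPayoff p i d c := by
    intro x c
    obtain hg' := (blackwellDominates_iff T.ζ _ _).1 ⟨g, hg⟩
    have h1 : ∀ x, signalCol T.ζ s'.1.1 x =
        ∑ x', g x' x • signalCol T.ζ (recExperiment p eZ (e i)) x' := by
      intro x
      simp only [signalCol, ← map_smul, ← map_sum]
      rw [weighted_eq_iff]
      intro θ z hz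
      simp [hg x θ z hz]
    rw [hζ] at h1 ⊢
    rw [signalCol_of_garbling eZ (e i) hp h1]
    simp [actionPayoff_recCol]
  calc _ = ∑ c, ∑ d, ρ d c * G.recPayoff p i d c := by
        refine sum_congr rfl fun c _ => ?_
        simp only [hρ, recPayoff, mul_sum]
        rw [sum_congr rfl fun am _ => sum_comm, sum_comm]
        exact sum_congr rfl fun _ _ => sum_congr rfl fun _ _ => sum_congr rfl fun _ _ => by ring
    _ = ∑ x, ∑ c, s'.2 x c * actionPayoff G eZ i c (signalCol T.ζ s'.1.1 x) := by
        simp only [hcol, ρ, mul_sum, sum_mul]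
        rw [sum_congr rfl fun c _ => sum_comm, sum_comm]
        exact sum_congr rfl fun _ _ => sum_congr rfl fun _ _ => sum_congr rfl fun _ _ => by ring
    _ ≤ ∑ x, ∑ c, s'.2 x c * maxPayoff G eZ i (signalCol T.ζ s'.1.1 x) :=
        sum_le_sum fun x _ => sum_le_sum fun c _ => mul_le_mul_of_nonneg_left
          (le_sup' (fun b => actionPayoff G eZ i b (signalCol T.ζ s'.1.1 x)) (mem_univ c))
          (stdSimplex.zero_le _ _)
    _ = _ := by
        simp [← sum_mul, signalSum]

end Recommendations

/-! ### The technology and the equivalence -/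

theorem IsSeparatedBCE.exists_technology [∀ i, Nonempty (A i)] (h : G.IsSeparatedBCE p)
    {v : I → ℝ}
    (hv : ∀ i, (v i = G.uninformedValue p i ∧ G.uninformedValue p i = G.grossValue p i) ∨
      v i ∈ Set.Ico (G.uninformedValue p i) (G.grossValue p i)) :
    ∃ T : InformationTechnology.{uI, uT, uA, w} I Θ A,
      T.IsRationalInattention ∧ G.Induces T p v := by
  classical
  obtain ⟨⟨hp, hob⟩, hsep⟩ := h
  have hΘ : Nonempty Θ := by
    by_contra hemp
    rw [not_nonempty_iff] at hemp
    simpa using G.prior_mem.2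
  let Z : Type w := ULift (Fin (Fintype.card (∀ i, A i)))
  let eZ : Z ≃ ∀ i, A i := Equiv.ulift.trans (Fintype.equivFin _).symm
  -- The sum plus one exceeds both cardinalities strictly.
  let X : I → Type w := fun i => ULift (Fin (Fintype.card (A i) + Fintype.card (Z × Θ) + 1))
  have hX : ∀ i, Fintype.card (X i) = Fintype.card (A i) + Fintype.card (Z × Θ) + 1 := fun i => by
    simp [X]
  have hXne : ∀ i, Nonempty (X i) := fun i => Fintype.card_pos_iff.1 (by rw [hX]; omega)
  have he : ∀ i, Nonempty (A i ↪ X i) := fun i =>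
    Function.Embedding.nonempty_of_card_le (by rw [hX]; omega)
  let e : ∀ i, A i ↪ X i := fun i => (he i).some
  choose σ hσ using fun i => exists_redraw hp.1 (e i)
  have hcost := fun i => exists_monotone_cost (ζ := recKernel eZ hp)
    (ξ := recExperiment p eZ (e i)) (isSublinear_maxPayoff (G := G) eZ i)
    (fun ξ' => blackwellDominates_recExperiment eZ (e i) hp hob hsep ξ')
    (k := G.grossValue p i - v i)
    (by rcases hv i with ⟨h1, h2⟩ | h1
        · linarith
        · linarith [h1.2])
    (by rw [signalSum_recExperiment eZ (e i) hp hob, maxPayoff_one]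
        rcases hv i with ⟨h1, h2⟩ | h1
        · linarith
        · linarith [h1.1])
    (by rw [signalSum_recExperiment eZ (e i) hp hob, maxPayoff_one]
        intro h0
        rcases hv i with ⟨h1, h2⟩ | h1
        · linarith
        · linarith [h1.2])
  choose cost hfree hmono hk hopt using hcost
  let T : InformationTechnology.{uI, uT, uA, w} I Θ A :=
    { Z := Z
      ζ := recKernel eZ hp
      X := X
      feasible := fun i => {ξ | BlackwellDominates (recKernel eZ hp) (recExperiment p eZ (e i)) ξ}
      cost := cost
      card_action_lt := fun i => by rw [hX]; omega
      card_state_lt := fun i => by rw [hX]; omega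
      exists_free := hfree }
  let s : ∀ i, T.Strategy i := fun i =>
    (⟨recExperiment p eZ (e i), BlackwellDominates.refl _ _⟩, σ i)
  have hs : IsRecommendation (T := T) p eZ e s := ⟨fun _ => rfl, hσ⟩
  have hout : G.outcome T s = p := hs.outcome_eq (hp := hp) rfl
  have hval : ∀ i, G.value T s i = v i := by
    intro i
    rw [value_eq, hout]
    have := hk i
    change G.grossValue p i - (cost i _ : ℝ) = v i
    rw [this]
    ring
  refine ⟨T, fun i => ⟨fun ξ hξ ξ' h => BlackwellDominates.trans hξ h, hmono i⟩, s,
    fun i s' => ?_, hout, funext hval⟩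
  -- Any deviation yields at most `signalSum` minus cost, hence at most `grossValue - k = v i`.
  refine (hs.value_update_le (hp := hp) rfl i s' s'.1.2).trans ((hopt i s'.1).trans ?_)
  rw [signalSum_recExperiment eZ (e i) hp hob, hval]
  linarith

end BaseGame

theorem theorem1 {I : Type uI} {Θ : Type uT} {A : I → Type uA}
    [Fintype I] [DecidableEq I] [Fintype Θ] [∀ i, Fintype (A i)] [∀ i, Nonempty (A i)]
    (G : BaseGame I Θ A) (p : (∀ i, A i) → Θ → ℝ) (v : I → ℝ) :
    (∃ T : InformationTechnology.{uI, uT, uA, w} I Θ A,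
        T.IsRationalInattention ∧ G.Induces T p v) ↔
      G.IsSeparatedBCE p ∧
        ∀ i, (v i = G.uninformedValue p i ∧ G.uninformedValue p i = G.grossValue p i) ∨
          v i ∈ Set.Ico (G.uninformedValue p i) (G.grossValue p i) :=
  ⟨fun ⟨_, hT, h⟩ => h.isSeparatedBCE_and_value hT, fun ⟨hp, hv⟩ => hp.exists_technology hv⟩
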